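/- **Setting.** Let $m\ge 2$. Hypergraphs are finite, have at least two vertices, are connected and $m$-uniform (edges form a set of $m$-element vertex subsets). Fix any linear ordering of the vertex set of each hypergraph considered. For a hypergraph $\mathcal H$ with $n$ vertices and an integer $d\ge 0$, a *rooted sequence* of length $d$ is $F=(e_1(v_1),\dots,e_d(v_d))$ with $e_i\in E(\mathcal H)$, a root $v_i\in e_i$ for each $i$, and $v_1\le\cdots\le v_d$. Let $r_F(v)$ be the number of indices $i$ with $v_i=v$. Let $R(F)$ be the directed multigraph that has, for each $i$, one arc from $v_i$ to each vertex of $e_i\setminus\{v_i\}$; its vertex set $V(F)$ is the set of ends of its arcs, and $d_F^+(v)$ is the outdegree of $v$ in it. Let $\mathcal F^\epsilon_d(\mathcal H)$ be the set of rooted sequences $F$ of length $d$ for which $R(F)$ is Eulerian, i.e. has a closed directed walk that uses every arc exactly once. For $d\ge1$ and $F\in\mathcal F^\epsilon_d(\mathcal H)$ put $$\omega(F)=\frac{d\,(m-1)^n\,\tau(F)}{\prod_{v\in V(F)}d_F^+(v)},$$ where $\tau(F)$ is the number of spanning trees of $R(F)$ directed towards a fixed root in $V(F)$ (as $R(F)$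 is Eulerian, it does not depend on the root). For a vertex $u$ of $\mathcal H$ let $$\mathrm{Tr}_d(\mathcal H;[u])=\sum_{F\in\mathcal F^\epsilon_d(\mathcal H),\ r_F(u)>0}\omega(F),\qquad \mathrm{Tr}_{d;t}(\mathcal H;[u])=\sum_{F\in\mathcal F^\epsilon_d(\mathcal H),\ r_F(u)=t}\omega(F)\quad(1\le t\le d),$$ and set $\mathrm{Tr}_{0;0}(\mathcal H;[u])=(m-1)^{n-1}$, $\mathrm{Tr}_{d;0}(\mathcal H;[u])=0$ for $d\ge1$ (this last value only occurs with coefficient $0$ below), and $\frac00:=1$. **Lemma.** Let $\mathcal H_1,\mathcal H_2$ be such hypergraphs with the same $m$, and let $v_1\in V(\mathcal H_1)$, $v_2\in V(\mathcal H_2)$. Let $\mathcal H=\mathcal H_1(v_1)\odot\mathcal H_2(v_2)$ be their coalescence, obtained from the disjoint union of $\mathcal H_1$ and $\mathcal H_2$ by identifying $v_1$ and $v_2$ to a new vertex $u$. Then for every integer $d\ge0$ $$\mathrm{Tr}_d(\mathcal H;[u])=\sum_{d_1+d_2=d}\ \sum_{\substack{0\le t_1\le d_1,\ 0\le t_2\le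 d_2\\ 0<t_1+t_2}}\frac{d}{t_1+t_2}\binom{t_1+t_2}{t_1}\cdot\frac{t_1}{d_1}\mathrm{Tr}_{d_1;t_1}(\mathcal H_1;[v_1])\cdot\frac{t_2}{d_2}\mathrm{Tr}_{d_2;t_2}(\mathcal H_2;[v_2]),$$ where $d_1,d_2$ range over the nonnegative integers. -/

import Mathlib

/-! ## Directed multigraphs -/

/-- A directed multigraph with arc type `A`; its vertices are the ends of its arcs (see `verts`). -/
structure MultiDigraph (V A : Type*) where
  src : A → V
  tgt : A → V

namespace MultiDigraph

/-- The vertex set: all tails and heads of arcs. -/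
def verts {V A : Type*} (D : MultiDigraph V A) : Set V :=
  Set.range D.src ∪ Set.range D.tgt

/-- The outdegree `d⁺(v)`, arcs counted with multiplicity. -/
noncomputable def outDegree {V A : Type*} (D : MultiDigraph V A) (v : V) : ℕ :=
  {a : A | D.src a = v}.ncard

/-- `D` has an Euler circuit: a cyclic sequence of arcs that contains every arc exactly once and in
which each arc begins where the preceding one ends. -/
def IsEulerian {V A : Type*} (D : MultiDigraph V A) : Prop :=
  ∃ c : Cycle A, c.Nodup ∧ (∀ a : A, a ∈ c) ∧ c.Chain (fun a b => D.tgt a = D.src b)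

/-- The set `T` of arcs is an arborescence with root `u`: a spanning tree of `D` directed towards
`u`. No arc of `T` leaves `u`, exactly one arc of `T` leaves every other vertex, and
from every vertex there is a directed path to `u` in `T`. -/
def IsArborescence {V A : Type*} (D : MultiDigraph V A) (u : V) (T : Set A) : Prop :=
  (∀ a ∈ T, D.src a ≠ u) ∧
  (∀ v ∈ D.verts, v ≠ u → ∃! a : A, a ∈ T ∧ D.src a = v) ∧
  (∀ v ∈ D.verts,
    Relation.ReflTransGen (fun x y => ∃ a ∈ T, D.src a = x ∧ D.tgt a = y) v u)

/-- `τ_u(D)`, the number of arborescences of `D` with root `u`. -/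
noncomputable def tauAt {V A : Type*} (D : MultiDigraph V A) (u : V) : ℕ :=
  {T : Set A | D.IsArborescence u T}.ncard

open Classical in
/-- `τ(D)`, the number of arborescences of `D` with a fixed root among the vertices of `D`. For
Eulerian `D`, the only ones to which it is applied, `τ_u(D)` does not depend on the vertex `u`. -/
noncomputable def tau {V A : Type*} (D : MultiDigraph V A) : ℕ :=
  if h : D.verts.Nonempty then D.tauAt h.choose else 0

end MultiDigraph

/-! ## Hypergraphs -/

/-- `H` is `m`-uniform, `m ≥ 2`. (Such a hypergraph is simple: no edge contains another one.) -/
def Hypergraph.IsUniform {α : Type*} (H : Hypergraph α) (m : ℕ) : Prop :=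
  2 ≤ m ∧ ∀ e ∈ H.edgeSet, e.ncard = m

/-- Every two vertices are connected by a walk. -/
def Hypergraph.IsConnected {α : Type*} (H : Hypergraph α) : Prop :=
  ∀ x ∈ H.vertexSet, ∀ y ∈ H.vertexSet, Relation.ReflTransGen H.Adj x y

/-! ## Coalescence -/

/-- The vertices available to a coalescence: the new vertex `u`, and the vertices of the two
hypergraphs. -/
inductive CoalVertex (α β : Type*)
  | glued : CoalVertex α β
  | left : α → CoalVertex α β
  | right : β → CoalVertex α β

namespace CoalVertex

open Classical in
/-- The vertices of the first hypergraph in the coalescence: `v₁` becomes the new vertex. -/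
noncomputable def ofLeft {α : Type*} (β : Type*) (v₁ : α) (x : α) : CoalVertex α β :=
  if x = v₁ then glued else left x

open Classical in
/-- The vertices of the second hypergraph in the coalescence: `v₂` becomes the new vertex. -/
noncomputable def ofRight (α : Type*) {β : Type*} (v₂ : β) (y : β) : CoalVertex α β :=
  if y = v₂ then glued else right y

end CoalVertex

/-- The coalescence `H₁(v₁) ⊙ H₂(v₂)`: the disjoint union of `H₁` and `H₂`, with `v₁` and `v₂`
identified to the new vertex `CoalVertex.glued`. -/
noncomputable def Hypergraph.coalescence {α β : Type*} (H₁ : Hypergraph α) (v₁ : α)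
    (H₂ : Hypergraph β) (v₂ : β) : Hypergraph (CoalVertex α β) where
  vertexSet := (H₁.image (CoalVertex.ofLeft β v₁)).vertexSet ∪
    (H₂.image (CoalVertex.ofRight α v₂)).vertexSet
  edgeSet := (H₁.image (CoalVertex.ofLeft β v₁)).edgeSet ∪
    (H₂.image (CoalVertex.ofRight α v₂)).edgeSet
  subset_vertexSet_of_mem_edgeSet' := by
    rintro e (he | he)
    · exact (Hypergraph.subset_vertexSet_of_mem_edgeSet he).trans Set.subset_union_left
    · exact (Hypergraph.subset_vertexSet_of_mem_edgeSet he).trans Set.subset_union_right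

/-! ## Sequences of rooted edges and their digraphs -/

/-- A rooted edge `e(v)`: a set `edge` of vertices and a vertex `root`. That `edge` is an edge of
the hypergraph at hand and contains `root` is required in `rootedSeqs`. -/
structure RootedEdge (α : Type*) where
  root : α
  edge : Set α

/-- The arcs of `R(F)`: the `j`-th rooted edge `e_j(v_j)` contributes one arc for each vertex of
`e_j` other than `v_j`. -/
abbrev StarArc {α : Type*} {d : ℕ} (F : Fin d → RootedEdge α) : Type _ :=
  {p : Fin d × α // p.2 ∈ (F p.1).edge ∧ p.2 ≠ (F p.1).root}

/-- The directed multigraph `R(F)`, the union with multiplicities of the stars directed from the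
root `v_j` to the other vertices of `e_j`. -/
def starUnion {α : Type*} {d : ℕ} (F : Fin d → RootedEdge α) : MultiDigraph α (StarArc F) where
  src := fun p => (F p.1.1).root
  tgt := fun p => p.1.2

/-- `r_F(v)`, the number of entries of `F` with root `v`. -/
noncomputable def rootCount {α : Type*} {d : ℕ} (F : Fin d → RootedEdge α) (v : α) : ℕ :=
  {i : Fin d | (F i).root = v}.ncard

namespace Hypergraph

/-- `𝓕_d(H)`: sequences of `d` rooted edges of `H` whose roots are in non-decreasing order. -/
def rootedSeqs {α : Type*} [LinearOrder α] (H : Hypergraph α) (d : ℕ) :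
    Set (Fin d → RootedEdge α) :=
  {F | (∀ i, (F i).edge ∈ H.edgeSet ∧ (F i).root ∈ (F i).edge) ∧
    ∀ i j, i ≤ j → (F i).root ≤ (F j).root}

/-- `𝓕^ε_d(H)`: those `F` in `𝓕_d(H)` for which `R(F)` is Eulerian. -/
def eulerSeqs {α : Type*} [LinearOrder α] (H : Hypergraph α) (d : ℕ) :
    Set (Fin d → RootedEdge α) :=
  {F | F ∈ H.rootedSeqs d ∧ (starUnion F).IsEulerian}

/-- `ω(F) = d (m - 1)ⁿ τ(F) / ∏_{v ∈ V(F)} d⁺_F(v)`, where `n` is the number of vertices of `H`. -/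
noncomputable def weight {α : Type*} (H : Hypergraph α) (m : ℕ) {d : ℕ}
    (F : Fin d → RootedEdge α) : ℚ :=
  (d : ℚ) * ((m : ℚ) - 1) ^ H.vertexSet.ncard * ((starUnion F).tau : ℚ) /
    ∏ᶠ v ∈ (starUnion F).verts, ((starUnion F).outDegree v : ℚ)

/-- `Tr_d(H; [u])`: the sum of `ω(F)` over all `F` in `𝓕^ε_d(H)` with `r_F(u) > 0`. -/
noncomputable def trAt {α : Type*} [LinearOrder α] (H : Hypergraph α) (m d : ℕ) (u : α) : ℚ :=
  ∑ᶠ F ∈ {F | F ∈ H.eulerSeqs d ∧ 0 < rootCount F u}, H.weight m F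

/-- `Tr_{d;t}(H; [u])`: the sum of `ω(F)` over all `F` in `𝓕^ε_d(H)` with `r_F(u) > 0` and
`r_F(u) = t`, except that `Tr_{0;0}` is `(m - 1)ⁿ⁻¹`, where `n` is the number of vertices of `H`. -/
noncomputable def trAtCount {α : Type*} [LinearOrder α] (H : Hypergraph α) (m d t : ℕ) (u : α) :
    ℚ :=
  if d = 0 ∧ t = 0 then ((m : ℚ) - 1) ^ (H.vertexSet.ncard - 1)
  else ∑ᶠ F ∈ {F | F ∈ H.eulerSeqs d ∧ 0 < rootCount F u ∧ rootCount F u = t}, H.weight m F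

end Hypergraph

/-- The quotient `t / d` of natural numbers as a rational number, with the convention
`0 / 0 = 1`. -/
def ratioOne (t d : ℕ) : ℚ :=
  if t = 0 ∧ d = 0 then 1 else (t : ℚ) / (d : ℚ)

/-!
The weight `ω(F)` of a sequence `F` with `t = r_F(u) > 0` is `d / t` times
`g(F) = (m - 1)ⁿ⁻¹ τ_u(F) / ∏_{v ≠ u} d⁺_F(v)` (`baseWeight`, `weight_eq`), because the root `u` may be
used to count spanning trees and `d⁺_F(u) = (m - 1) t`. With the stated conventions,
`(t / d) Tr_{d;t}` is then the sum of `g(F)` over the `F` with `r_F(u) = t`, also for `t = 0`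
(`ratioOne_mul_trAtCount`).

A sequence `F` of the coalescence is a shuffle of a sequence `F₁` of `H₁` and a sequence `F₂` of `H₂`,
and `R(F)` consists of `R(F₁)` and `R(F₂)` glued at `u`. An Euler tour based at `u` restricts to
Euler tours of the two parts, and two such tours can be concatenated; an arborescence with root `u`
is a pair of arborescences of the parts. Hence `g(F) = g(F₁) g(F₂)` (`IsMerge.baseWeight_eq`). It
remains that `F₁` and `F₂` come from `(t₁ + t₂).choose t₁` sequences `F`, one for each shuffle of the
edges rooted at `u`. The order of the vertices of the coalescence is unrelated to those of `H₁` and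
`H₂`, so this is counted through unsorted sequences: a sum over sorted sequences of length `d` is
`1 / d!` times the sum over all sequences weighted by `∏ r_F(v)!` (`factorial_mul_sum_sorted`), and
all sequences of the coalescence are split by the set of positions of the edges of `H₁`
(`sum_tuple_sum`). The binomial coefficient comes from `r_F(u)! = (t₁ + t₂)!`
(`IsMerge.symmetryFactor_eq`).

That the number of arborescences of an Eulerian digraph does not depend on the root
(`MultiDigraph.IsEulerian.tauAt_eq`) is proved without determinants. Both `d⁺(v) τ_v` and the sum of
`τ_w` over all arcs from `w` to `v` count the arc sets with exactly one arc out of every vertex along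
which every vertex reaches `v`. As indegrees equal outdegrees, `τ` is harmonic, and so it is constant
by strong connectivity.
-/

namespace MultiDigraph

variable {V A : Type*}

/-! ### Walks and Euler tours -/

/-- `D.IsWalk x l y`: the list `l` of arcs is a directed walk from `x` to `y`. -/
def IsWalk (D : MultiDigraph V A) : V → List A → V → Prop
  | x, [], y => x = y
  | x, a :: l, y => D.src a = x ∧ D.IsWalk (D.tgt a) l y

/-- `D` has an Euler tour based at `u`: a closed walk from `u` to `u` that uses every arc exactly
once. A digraph without arcs has an Euler tour based at every vertex. -/
def IsTour (D : MultiDigraph V A) (u : V) : Prop :=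
  ∃ l : List A, l.Nodup ∧ (∀ a, a ∈ l) ∧ D.IsWalk u l u

/-- `D.Reach T x y`: there is a directed walk from `x` to `y` with all its arcs in `T`. -/
abbrev Reach (D : MultiDigraph V A) (T : Set A) : V → V → Prop :=
  Relation.ReflTransGen (fun x y => ∃ a ∈ T, D.src a = x ∧ D.tgt a = y)

theorem isWalk_append (D : MultiDigraph V A) {x z : V} {l l' : List A} :
    D.IsWalk x (l ++ l') z ↔ ∃ y, D.IsWalk x l y ∧ D.IsWalk y l' z := by
  induction l generalizing x with
  | nil => simp [IsWalk]
  | cons a l ih => simp [IsWalk, ih, and_assoc]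

theorem isWalk_iff_isChain (D : MultiDigraph V A) {a : A} {l : List A} {b : A} :
    D.IsWalk (D.src a) (a :: l) (D.src b) ↔
      List.IsChain (fun a b => D.tgt a = D.src b) (a :: (l ++ [b])) := by
  induction l generalizing a with
  | nil => simp [IsWalk]
  | cons c l ih =>
    rw [List.cons_append, List.isChain_cons_cons, ← ih]
    simp only [IsWalk, true_and]
    constructor
    · rintro ⟨h, h'⟩; exact ⟨h.symm, h'⟩
    · rintro ⟨h, h'⟩; exact ⟨h.symm, h'⟩

/-- An Euler circuit may be cut open at any arc. -/
theorem IsEulerian.isTour {D : MultiDigraph V A} (h : D.IsEulerian) (b : A) :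
    D.IsTour (D.src b) := by
  obtain ⟨c, hn, hall, hc⟩ := h
  induction c using Quotient.inductionOn' with
  | h l =>
    obtain ⟨s, t, rfl⟩ := List.append_of_mem (show b ∈ l from hall b)
    have e : ((s ++ b :: t : List A) : Cycle A) = ((b :: (t ++ s) : List A) : Cycle A) :=
      Cycle.coe_eq_coe.2 (by simpa using List.isRotated_append (l := s) (l' := b :: t))
    have hn' : Cycle.Nodup ((s ++ b :: t : List A) : Cycle A) := hn
    have hc' : Cycle.Chain (fun a b => D.tgt a = D.src b) ((s ++ b :: t : List A) : Cycle A) := hc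
    rw [e] at hn' hc'
    refine ⟨b :: (t ++ s), hn', fun a => ?_, ?_⟩
    · have := (show a ∈ s ++ b :: t from hall a)
      simp only [List.mem_append, List.mem_cons] at this ⊢
      tauto
    · rw [isWalk_iff_isChain]; exact hc'

theorem IsTour.isEulerian {D : MultiDigraph V A} {u : V} (h : D.IsTour u) : D.IsEulerian := by
  obtain ⟨l, hn, hall, hw⟩ := h
  refine ⟨(l : Cycle A), hn, hall, ?_⟩
  cases l with
  | nil => exact Cycle.Chain.nil _
  | cons a l =>
    obtain rfl : D.src a = u := hw.1
    exact D.isWalk_iff_isChain.1 hw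

theorem IsTour.exists_src_eq [Nonempty A] {D : MultiDigraph V A} {u : V} (h : D.IsTour u) :
    ∃ a, D.src a = u := by
  obtain ⟨l, -, hall, hw⟩ := h
  cases l with
  | nil => exact absurd (hall (Classical.arbitrary A)) (by simp)
  | cons a l => exact ⟨a, hw.1⟩

theorem IsWalk.reach {D : MultiDigraph V A} {x y : V} {l : List A} (h : D.IsWalk x l y) :
    D.Reach Set.univ x y ∧
      ∀ a ∈ l, D.Reach Set.univ x (D.src a) ∧ D.Reach Set.univ (D.tgt a) y := by
  induction l generalizing x with
  | nil => obtain rfl : x = y := h; exact ⟨.refl, by simp⟩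
  | cons a l ih =>
    obtain ⟨rfl, h⟩ := h
    obtain ⟨h1, h2⟩ := ih h
    have step : D.Reach Set.univ (D.src a) (D.tgt a) := .single ⟨a, trivial, rfl, rfl⟩
    refine ⟨step.trans h1, fun b hb => ?_⟩
    rcases List.mem_cons.1 hb with rfl | hb
    · exact ⟨.refl, h1⟩
    · exact ⟨step.trans (h2 b hb).1, (h2 b hb).2⟩

/-- In an Eulerian digraph every vertex reaches every other. -/
theorem IsEulerian.reach {D : MultiDigraph V A} (h : D.IsEulerian) {x y : V}
    (hx : x ∈ D.verts) (hy : y ∈ D.verts) : D.Reach Set.univ x y := by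
  have key : ∀ x ∈ D.verts, ∃ b, D.Reach Set.univ x (D.src b) := by
    rintro x (⟨b, rfl⟩ | ⟨b, rfl⟩)
    · exact ⟨b, .refl⟩
    · obtain ⟨l, -, hall, hw⟩ := h.isTour b
      exact ⟨b, (hw.reach.2 b (hall b)).2⟩
  obtain ⟨b, hb⟩ := key x hx
  obtain ⟨l, -, hall, hw⟩ := h.isTour b
  refine hb.trans ?_
  rcases hy with ⟨c, rfl⟩ | ⟨c, rfl⟩
  · exact (hw.reach.2 c (hall c)).1
  · exact (hw.reach.2 c (hall c)).1.tail ⟨c, trivial, rfl, rfl⟩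

open Classical in
theorem IsWalk.countP_add {D : MultiDigraph V A} {x y : V} {l : List A} (h : D.IsWalk x l y)
    (v : V) :
    l.countP (fun a => D.src a = v) + (if y = v then 1 else 0) =
      l.countP (fun a => D.tgt a = v) + (if x = v then 1 else 0) := by
  induction l generalizing x with
  | nil => obtain rfl : x = y := h; simp
  | cons a l ih =>
    obtain ⟨rfl, h⟩ := h
    have := ih h
    simp only [List.countP_cons, decide_eq_true_eq]
    omega

open Classical in
/-- An Eulerian digraph is balanced: outdegrees equal indegrees. -/
theorem IsEulerian.balanced [Fintype A] {D : MultiDigraph V A} (h : D.IsEulerian) (v : V) :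
    (Finset.univ.filter fun a => D.src a = v).card =
      (Finset.univ.filter fun a => D.tgt a = v).card := by
  rcases isEmpty_or_nonempty A with hA | ⟨⟨b⟩⟩
  · simp [Finset.univ_eq_empty]
  obtain ⟨l, hn, hall, hw⟩ := h.isTour b
  have e : (Finset.univ : Finset A) = l.toFinset := by ext a; simp [hall a]
  have key : ∀ p : A → Prop, (Finset.univ.filter p).card = l.countP (fun a => p a) := by
    intro p
    have e2 : Finset.univ.filter p = (l.filter (fun a => p a)).toFinset := by
      ext a; simp [hall a]
    rw [e2, List.toFinset_card_of_nodup (hn.filter _), List.countP_eq_length_filter]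
  have := hw.countP_add v
  rw [key, key]
  simpa using this

/-! ### The number of arborescences of an Eulerian digraph does not depend on the root -/

/-- `U` contains exactly one arc out of every vertex of `D`, and along the arcs of `U` every vertex
reaches `w`. If `w` is a vertex of `D`, it then lies on the only cycle of `U`. -/
def IsUnicyclic (D : MultiDigraph V A) (w : V) (U : Set A) : Prop :=
  (∀ v ∈ D.verts, ∃! a : A, a ∈ U ∧ D.src a = v) ∧ ∀ v ∈ D.verts, D.Reach U v w

theorem src_mem_verts (D : MultiDigraph V A) (a : A) : D.src a ∈ D.verts := .inl ⟨a, rfl⟩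
theorem tgt_mem_verts (D : MultiDigraph V A) (a : A) : D.tgt a ∈ D.verts := .inr ⟨a, rfl⟩

theorem Reach.mono {D : MultiDigraph V A} {T U : Set A} (h : T ⊆ U) {x y : V}
    (hr : D.Reach T x y) : D.Reach U x y :=
  Relation.ReflTransGen.mono (fun _ _ ⟨a, ha, h'⟩ => ⟨a, h ha, h'⟩) _ _ hr

/-- A walk to `w` needs no arc out of `w`. -/
theorem Reach.diff {D : MultiDigraph V A} {U : Set A} {a : A} {x : V}
    (hr : D.Reach U x (D.src a)) : D.Reach (U \ {a}) x (D.src a) := by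
  induction hr using Relation.ReflTransGen.head_induction_on with
  | refl => exact .refl
  | head h _ ih =>
    obtain ⟨b, hb, rfl, rfl⟩ := h
    by_cases hab : b = a
    · subst hab; exact .refl
    · exact .head ⟨b, ⟨hb, hab⟩, rfl, rfl⟩ ih

theorem IsArborescence.isUnicyclic_insert {D : MultiDigraph V A} {T : Set A} {a : A}
    (h : D.IsArborescence (D.src a) T) : a ∉ T ∧ D.IsUnicyclic (D.src a) (insert a T) := by
  obtain ⟨h1, h2, h3⟩ := h
  refine ⟨fun ha => h1 a ha rfl, fun v hv => ?_, fun v hv =>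
    Reach.mono (Set.subset_insert _ _) (h3 v hv)⟩
  by_cases hva : v = D.src a
  · subst hva
    refine ⟨a, ⟨Set.mem_insert _ _, rfl⟩, ?_⟩
    rintro b ⟨rfl | hb, hb'⟩
    · rfl
    · exact absurd hb' (h1 b hb)
  · obtain ⟨b, ⟨hb, hbv⟩, hb'⟩ := h2 v hv hva
    refine ⟨b, ⟨Set.mem_insert_of_mem _ hb, hbv⟩, ?_⟩
    rintro c ⟨rfl | hc, hc'⟩
    · exact absurd hc'.symm hva
    · exact hb' c ⟨hc, hc'⟩

theorem IsUnicyclic.isArborescence_diff {D : MultiDigraph V A} {U : Set A} {a : A} (ha : a ∈ U)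
    (h : D.IsUnicyclic (D.src a) U) : D.IsArborescence (D.src a) (U \ {a}) := by
  obtain ⟨h1, h2⟩ := h
  refine ⟨fun b hb hba => hb.2 ?_, fun v hv hva => ?_, fun v hv => Reach.diff (h2 v hv)⟩
  · exact (h1 _ (D.src_mem_verts a)).unique ⟨hb.1, hba⟩ ⟨ha, rfl⟩
  · obtain ⟨b, ⟨hb, rfl⟩, hb'⟩ := h1 v hv
    exact ⟨b, ⟨⟨hb, fun h => hva (congrArg D.src h)⟩, rfl⟩, fun c hc => hb' c ⟨hc.1.1, hc.2⟩⟩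

/-- The cycle of a unicyclic arc set enters `v` by exactly one arc. -/
theorem IsUnicyclic.existsUnique_enter {D : MultiDigraph V A} {U : Set A} {v : V}
    (hv : v ∈ D.verts) (h : D.IsUnicyclic v U) :
    ∃! a : A, a ∈ U ∧ D.tgt a = v ∧ D.Reach U v (D.src a) := by
  obtain ⟨h1, h2⟩ := h
  have : Nonempty A := ⟨(h1 v hv).choose⟩
  choose! f hf using fun v hv => (h1 v hv).exists
  have hf' : ∀ a ∈ U, f (D.src a) = a := fun a ha =>
    (h1 _ (D.src_mem_verts a)).unique (hf _ (D.src_mem_verts a)) ⟨ha, rfl⟩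
  -- The successor map along `U`, whose orbits are the walks in `U`.
  set g : V → V := fun x => D.tgt (f x) with hg
  have hgv : ∀ n, g^[n] v ∈ D.verts := by
    intro n
    induction n with
    | zero => exact hv
    | succ n _ => rw [Function.iterate_succ_apply']; exact D.tgt_mem_verts _
  have reach_iter : ∀ n, D.Reach U v (g^[n] v) := by
    intro n
    induction n with
    | zero => exact .refl
    | succ n ih =>
      rw [Function.iterate_succ_apply']
      exact ih.tail ⟨f _, (hf _ (hgv n)).1, (hf _ (hgv n)).2, rfl⟩
  have iter_of_reach : ∀ w, D.Reach U v w → ∃ n, w = g^[n] v := by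
    intro w hw
    induction hw with
    | refl => exact ⟨0, rfl⟩
    | tail _ h ih =>
      obtain ⟨n, rfl⟩ := ih
      obtain ⟨a, ha, has, rfl⟩ := h
      exact ⟨n + 1, by rw [Function.iterate_succ_apply', hg, ← has]; simp only [hf' a ha]⟩
  have hper : v ∈ Function.periodicPts g := by
    obtain ⟨n, hn⟩ : ∃ n, g^[n + 1] v = v := by
      have hr := h2 _ (D.tgt_mem_verts (f v))
      have key : ∀ w, D.Reach U w v → w ∈ D.verts → ∃ n, g^[n] w = v := by
        intro w hw
        induction hw using Relation.ReflTransGen.head_induction_on with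
        | refl => exact fun _ => ⟨0, rfl⟩
        | head h _ ih =>
          intro _
          obtain ⟨a, ha, rfl, rfl⟩ := h
          obtain ⟨n, hn⟩ := ih (D.tgt_mem_verts a)
          exact ⟨n + 1, by rw [Function.iterate_succ_apply, ← hn, hg]; simp only [hf' a ha]⟩
      obtain ⟨n, hn⟩ := key _ hr (D.tgt_mem_verts _)
      exact ⟨n, by rw [Function.iterate_succ_apply]; exact hn⟩
    exact Function.mk_mem_periodicPts (Nat.succ_pos n) hn
  set p := Function.minimalPeriod g v with hp
  have hp0 : 0 < p := Function.minimalPeriod_pos_of_mem_periodicPts hper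
  refine ⟨f (g^[p - 1] v), ⟨(hf _ (hgv _)).1, ?_, ?_⟩, ?_⟩
  · change g (g^[p - 1] v) = v
    rw [← Function.iterate_succ_apply' g, Nat.succ_eq_add_one, Nat.sub_add_cancel hp0]
    exact Function.iterate_minimalPeriod
  · rw [(hf _ (hgv _)).2]; exact reach_iter _
  · rintro a ⟨ha, hav, har⟩
    obtain ⟨n, hn⟩ := iter_of_reach _ har
    have hper' : Function.IsPeriodicPt g (n + 1) v := by
      change g^[n + 1] v = v
      rw [Function.iterate_succ_apply', ← hn, hg]
      simp only [hf' a ha, hav]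
    obtain ⟨k, hk⟩ := hper'.minimalPeriod_dvd
    have hk0 : k ≠ 0 := by rintro rfl; simp at hk
    obtain ⟨k, rfl⟩ := Nat.exists_eq_succ_of_ne_zero hk0
    have hn' : n = (p - 1) + p * k := by
      have : n + 1 = p * k + p := by rw [hk, ← hp, Nat.mul_succ]
      omega
    have : g^[n] v = g^[p - 1] v := by
      have h3 : Function.IsPeriodicPt g (p * k) v :=
        (Function.isPeriodicPt_minimalPeriod g v).mul_const k
      rw [hn', Function.iterate_add_apply, h3.eq]
    rw [← this, ← hn, hf' a ha]

/-- `d⁺(v) τ_v` counts the unicyclic arc sets through `v`, by their arc out of `v`. -/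
theorem outDegree_mul_tauAt [Finite A] (D : MultiDigraph V A) {v : V} (hv : v ∈ D.verts) :
    D.outDegree v * D.tauAt v = {U : Set A | D.IsUnicyclic v U}.ncard := by
  rw [outDegree, tauAt, ← Set.ncard_prod]
  refine Set.ncard_congr (fun p _ => insert p.1 p.2) ?_ ?_ ?_
  · rintro ⟨a, T⟩ ⟨rfl : D.src a = v, hT⟩
    exact (IsArborescence.isUnicyclic_insert hT).2
  · rintro ⟨a, T⟩ ⟨b, S⟩ ⟨rfl : D.src a = v, hT : D.IsArborescence (D.src a) T⟩
      ⟨hb : D.src b = D.src a, hS : D.IsArborescence (D.src a) S⟩ h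
    have hT' := IsArborescence.isUnicyclic_insert hT
    have hS' := IsArborescence.isUnicyclic_insert (a := b) (hb ▸ hS)
    simp only at h
    obtain rfl : b = a := (hT'.2.1 _ hv).unique ⟨h ▸ Set.mem_insert _ _, hb⟩
      ⟨Set.mem_insert _ _, rfl⟩
    have : T = S := by
      rw [← Set.insert_sdiff_self_of_notMem hT'.1, h, Set.insert_sdiff_self_of_notMem hS'.1]
    rw [this]
  · intro U hU
    obtain ⟨a, ⟨ha, rfl⟩, -⟩ := hU.1 v hv
    exact ⟨(a, U \ {a}), ⟨rfl, hU.isArborescence_diff ha⟩, Set.insert_sdiff_self_of_mem ha⟩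

open Classical in
/-- The sum of `τ_w` over the arcs from `w` to `v` counts the same sets, by the arc of the cycle
that enters `v`. -/
theorem sum_tauAt_eq [Fintype A] (D : MultiDigraph V A) {v : V} (hv : v ∈ D.verts) :
    ∑ a with D.tgt a = v, D.tauAt (D.src a) = {U : Set A | D.IsUnicyclic v U}.ncard := by
  have h1 : ∑ a with D.tgt a = v, D.tauAt (D.src a) =
      ((Finset.univ.filter fun a => D.tgt a = v).sigma fun a =>
        (Finset.univ.filter fun T : Set A => D.IsArborescence (D.src a) T)).card := by
    rw [Finset.card_sigma]
    refine Finset.sum_congr rfl fun a _ => ?_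
    rw [tauAt, Set.ncard_eq_toFinset_card', Set.toFinset_ofPred]
  rw [h1, Set.ncard_eq_toFinset_card', Set.toFinset_ofPred]
  refine Finset.card_bij (fun p _ => insert p.1 p.2) ?_ ?_ ?_
  · rintro ⟨a, T⟩ h
    simp only [Finset.mem_sigma, Finset.mem_filter, Finset.mem_univ, true_and] at h ⊢
    obtain ⟨rfl, hT⟩ := h
    have hT' := (IsArborescence.isUnicyclic_insert hT).2
    exact ⟨hT'.1, fun x hx => (hT'.2 x hx).tail ⟨a, Set.mem_insert _ _, rfl, rfl⟩⟩
  · rintro ⟨a, T⟩ h ⟨b, S⟩ h' heq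
    simp only [Finset.mem_sigma, Finset.mem_filter, Finset.mem_univ, true_and] at h h' heq
    obtain ⟨rfl, hT⟩ := h
    obtain ⟨hb, hS⟩ := h'
    have hT' := IsArborescence.isUnicyclic_insert hT
    have hS' := IsArborescence.isUnicyclic_insert hS
    have hU : D.IsUnicyclic (D.tgt a) (insert a T) :=
      ⟨hT'.2.1, fun x hx => (hT'.2.2 x hx).tail ⟨a, Set.mem_insert _ _, rfl, rfl⟩⟩
    obtain rfl : b = a := (hU.existsUnique_enter hv).unique
      ⟨heq ▸ Set.mem_insert _ _, hb, heq ▸ hS'.2.2 _ (hb ▸ D.tgt_mem_verts b)⟩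
      ⟨Set.mem_insert _ _, rfl, hT'.2.2 _ hv⟩
    have : T = S := by
      rw [← Set.insert_sdiff_self_of_notMem hT'.1, heq, Set.insert_sdiff_self_of_notMem hS'.1]
    rw [this]
  · intro U hU
    simp only [Finset.mem_filter, Finset.mem_univ, true_and] at hU
    obtain ⟨a, ⟨ha, rfl, har⟩, -⟩ := hU.existsUnique_enter hv
    refine ⟨⟨a, U \ {a}⟩, ?_, Set.insert_sdiff_self_of_mem ha⟩
    simp only [Finset.mem_sigma, Finset.mem_filter, Finset.mem_univ, true_and]
    exact IsUnicyclic.isArborescence_diff ha ⟨hU.1, fun x hx => (hU.2 x hx).trans har⟩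

/-- By balance `τ` is a harmonic function, and it is constant by the maximum principle. -/
theorem IsEulerian.tauAt_eq [Finite A] {D : MultiDigraph V A} (h : D.IsEulerian) {u v : V}
    (hu : u ∈ D.verts) (hv : v ∈ D.verts) : D.tauAt u = D.tauAt v := by
  classical
  have := Fintype.ofFinite A
  have hfin : D.verts.Finite := (Set.finite_range _).union (Set.finite_range _)
  obtain ⟨w, hw, hmax⟩ := hfin.exists_maximalFor D.tauAt _ ⟨u, hu⟩
  have hle : ∀ x ∈ D.verts, D.tauAt x ≤ D.tauAt w := fun x hx =>
    (le_total (D.tauAt x) (D.tauAt w)).elim id (hmax hx)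
  suffices key : ∀ x, D.Reach Set.univ x w → D.tauAt x = D.tauAt w from
    (key u (h.reach hu hw)).trans (key v (h.reach hv hw)).symm
  intro x hx
  induction hx using Relation.ReflTransGen.head_induction_on with
  | refl => rfl
  | @head x y hxy _ ih =>
    obtain ⟨a, -, rfl, rfl⟩ := hxy
    have h1 := (D.sum_tauAt_eq (D.tgt_mem_verts a)).trans
      (D.outDegree_mul_tauAt (D.tgt_mem_verts a)).symm
    rw [outDegree, Set.ncard_eq_toFinset_card', Set.toFinset_ofPred, h.balanced, ih,
      ← smul_eq_mul, ← Finset.sum_const] at h1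
    exact (Finset.sum_eq_sum_iff_of_le fun b _ => hle _ (D.src_mem_verts b)).1 h1 a (by simp)

theorem IsEulerian.tau_eq [Finite A] {D : MultiDigraph V A} (h : D.IsEulerian) {u : V}
    (hu : u ∈ D.verts) : D.tau = D.tauAt u := by
  have hne : D.verts.Nonempty := ⟨u, hu⟩
  rw [tau, dif_pos hne]
  exact h.tauAt_eq hne.choose_spec hu

end MultiDigraph

namespace MultiDigraph

/-! ### Digraphs glued at a vertex -/

/-- `D` is the union of a copy of `D₁` and a copy of `D₂` that share no arcs and, of the vertices,
only `u`, the common image of `v₁` and `v₂`. The copies are given by the maps `f₁`, `f₂` of vertices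
and `j₁`, `j₂` of arcs. -/
structure IsGluing {V V₁ V₂ A A₁ A₂ : Type*} (D : MultiDigraph V A) (D₁ : MultiDigraph V₁ A₁)
    (D₂ : MultiDigraph V₂ A₂) (u : V) (v₁ : V₁) (v₂ : V₂) (f₁ : V₁ → V) (f₂ : V₂ → V)
    (j₁ : A₁ → A) (j₂ : A₂ → A) : Prop where
  inj_f₁ : f₁.Injective
  inj_f₂ : f₂.Injective
  f₁_base : f₁ v₁ = u
  f₂_base : f₂ v₂ = u
  eq_base : ∀ x y, f₁ x = f₂ y → f₁ x = u
  inj_j₁ : j₁.Injective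
  inj_j₂ : j₂.Injective
  disj : ∀ a b, j₁ a ≠ j₂ b
  cover : ∀ a, (∃ b, j₁ b = a) ∨ ∃ b, j₂ b = a
  src₁ : ∀ a, D.src (j₁ a) = f₁ (D₁.src a)
  tgt₁ : ∀ a, D.tgt (j₁ a) = f₁ (D₁.tgt a)
  src₂ : ∀ a, D.src (j₂ a) = f₂ (D₂.src a)
  tgt₂ : ∀ a, D.tgt (j₂ a) = f₂ (D₂.tgt a)

namespace IsGluing

variable {V V₁ V₂ A A₁ A₂ : Type*} {D : MultiDigraph V A} {D₁ : MultiDigraph V₁ A₁}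
  {D₂ : MultiDigraph V₂ A₂} {u : V} {v₁ : V₁} {v₂ : V₂} {f₁ : V₁ → V} {f₂ : V₂ → V}
  {j₁ : A₁ → A} {j₂ : A₂ → A}

theorem symm (h : IsGluing D D₁ D₂ u v₁ v₂ f₁ f₂ j₁ j₂) :
    IsGluing D D₂ D₁ u v₂ v₁ f₂ f₁ j₂ j₁ where
  inj_f₁ := h.inj_f₂
  inj_f₂ := h.inj_f₁
  f₁_base := h.f₂_base
  f₂_base := h.f₁_base
  eq_base := fun x y e => e.trans (h.eq_base y x e.symm)
  inj_j₁ := h.inj_j₂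
  inj_j₂ := h.inj_j₁
  disj := fun a b e => h.disj b a e.symm
  cover := fun a => (h.cover a).symm
  src₁ := h.src₂
  tgt₁ := h.tgt₂
  src₂ := h.src₁
  tgt₂ := h.tgt₁

/-- The retraction of the glued vertex set onto its first part, which sends the second part to the
base vertex. -/
theorem exists_retraction (h : IsGluing D D₁ D₂ u v₁ v₂ f₁ f₂ j₁ j₂) :
    ∃ π : V → V₁, (∀ x, π (f₁ x) = x) ∧ ∀ y, π (f₂ y) = v₁ := by
  classical
  refine ⟨fun w => if hw : ∃ x, f₁ x = w then hw.choose else v₁, fun x => ?_, fun y => ?_⟩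
  · have hx : ∃ x', f₁ x' = f₁ x := ⟨x, rfl⟩
    simp only [dif_pos hx]
    exact h.inj_f₁ hx.choose_spec
  · by_cases hy : ∃ x, f₁ x = f₂ y
    · simp only [dif_pos hy]
      exact h.inj_f₁ ((h.eq_base _ _ hy.choose_spec).trans h.f₁_base.symm)
    · simp only [dif_neg hy]

/-- A retraction turns a walk into a walk, once the arcs of the second part are dropped. -/
theorem exists_isWalk (h : IsGluing D D₁ D₂ u v₁ v₂ f₁ f₂ j₁ j₂) {π : V → V₁}
    (hπ₁ : ∀ x, π (f₁ x) = x) (hπ₂ : ∀ y, π (f₂ y) = v₁) {x y : V} {l : List A}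
    (hw : D.IsWalk x l y) :
    ∃ l₁ : List A₁, D₁.IsWalk (π x) l₁ (π y) ∧ (l₁.map j₁).Sublist l ∧
      ∀ a, j₁ a ∈ l → a ∈ l₁ := by
  induction l generalizing x with
  | nil => obtain rfl : x = y := hw; exact ⟨[], rfl, by simp, by simp⟩
  | cons a l ih =>
    obtain ⟨rfl, hw⟩ := hw
    obtain ⟨l₁, h1, h2, h3⟩ := ih hw
    rcases h.cover a with ⟨b, rfl⟩ | ⟨b, rfl⟩
    · refine ⟨b :: l₁, ⟨?_, ?_⟩, by simpa using h2, fun c hc => ?_⟩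
      · rw [h.src₁, hπ₁]
      · rwa [h.tgt₁, hπ₁] at h1
      · rcases List.mem_cons.1 hc with hc | hc
        · rw [h.inj_j₁ hc]; exact List.mem_cons_self
        · exact List.mem_cons_of_mem _ (h3 c hc)
    · refine ⟨l₁, ?_, h2.cons _, fun c hc => ?_⟩
      · rw [h.tgt₂, hπ₂] at h1
        rwa [h.src₂, hπ₂]
      · rcases List.mem_cons.1 hc with hc | hc
        · exact absurd hc (h.disj _ _)
        · exact h3 c hc

theorem isTour_left (h : IsGluing D D₁ D₂ u v₁ v₂ f₁ f₂ j₁ j₂) (ht : D.IsTour u) :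
    D₁.IsTour v₁ := by
  obtain ⟨π, hπ₁, hπ₂⟩ := h.exists_retraction
  obtain ⟨l, hn, hall, hw⟩ := ht
  obtain ⟨l₁, h1, h2, h3⟩ := h.exists_isWalk hπ₁ hπ₂ hw
  rw [← h.f₁_base, hπ₁] at h1
  exact ⟨l₁, (hn.sublist h2).of_map, fun a => h3 a (hall _), h1⟩

theorem isWalk_map (h : IsGluing D D₁ D₂ u v₁ v₂ f₁ f₂ j₁ j₂) {x y : V₁} {l : List A₁}
    (hw : D₁.IsWalk x l y) : D.IsWalk (f₁ x) (l.map j₁) (f₁ y) := by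
  induction l generalizing x with
  | nil => exact congrArg f₁ hw
  | cons a l ih =>
    obtain ⟨rfl, hw⟩ := hw
    exact ⟨h.src₁ a, by rw [h.tgt₁]; exact ih hw⟩

theorem isTour_iff (h : IsGluing D D₁ D₂ u v₁ v₂ f₁ f₂ j₁ j₂) :
    D.IsTour u ↔ D₁.IsTour v₁ ∧ D₂.IsTour v₂ := by
  refine ⟨fun ht => ⟨h.isTour_left ht, h.symm.isTour_left ht⟩, ?_⟩
  rintro ⟨⟨l₁, hn₁, hall₁, hw₁⟩, ⟨l₂, hn₂, hall₂, hw₂⟩⟩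
  refine ⟨l₁.map j₁ ++ l₂.map j₂, ?_, fun a => ?_, ?_⟩
  · refine List.Nodup.append (hn₁.map h.inj_j₁) (hn₂.map h.inj_j₂) ?_
    intro a ha hb
    obtain ⟨a, -, rfl⟩ := List.mem_map.1 ha
    obtain ⟨b, -, hb⟩ := List.mem_map.1 hb
    exact h.disj a b hb.symm
  · rcases h.cover a with ⟨b, rfl⟩ | ⟨b, rfl⟩
    · exact List.mem_append_left _ (List.mem_map_of_mem (hall₁ b))
    · exact List.mem_append_right _ (List.mem_map_of_mem (hall₂ b))
  · have e₁ := h.isWalk_map hw₁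
    have e₂ := h.symm.isWalk_map hw₂
    rw [h.f₁_base] at e₁
    rw [h.f₂_base] at e₂
    exact D.isWalk_append.2 ⟨u, e₁, e₂⟩

theorem mem_verts (h : IsGluing D D₁ D₂ u v₁ v₂ f₁ f₂ j₁ j₂) {x : V₁} (hx : x ∈ D₁.verts) :
    f₁ x ∈ D.verts := by
  rcases hx with ⟨a, rfl⟩ | ⟨a, rfl⟩
  · exact h.src₁ a ▸ D.src_mem_verts _
  · exact h.tgt₁ a ▸ D.tgt_mem_verts _

theorem exists_of_mem_verts (h : IsGluing D D₁ D₂ u v₁ v₂ f₁ f₂ j₁ j₂) {w : V}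
    (hw : w ∈ D.verts) : (∃ x ∈ D₁.verts, f₁ x = w) ∨ ∃ y ∈ D₂.verts, f₂ y = w := by
  rcases hw with ⟨a, rfl⟩ | ⟨a, rfl⟩ <;> rcases h.cover a with ⟨b, rfl⟩ | ⟨b, rfl⟩
  · exact .inl ⟨_, D₁.src_mem_verts b, (h.src₁ b).symm⟩
  · exact .inr ⟨_, D₂.src_mem_verts b, (h.src₂ b).symm⟩
  · exact .inl ⟨_, D₁.tgt_mem_verts b, (h.tgt₁ b).symm⟩
  · exact .inr ⟨_, D₂.tgt_mem_verts b, (h.tgt₂ b).symm⟩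

/-- Away from the base vertex, the arcs out of a vertex of the first part are arcs of the first
part. -/
theorem existsUnique_iff (h : IsGluing D D₁ D₂ u v₁ v₂ f₁ f₂ j₁ j₂) (T : Set A) {x : V₁}
    (hx : x ≠ v₁) :
    (∃! a, a ∈ T ∧ D.src a = f₁ x) ↔ ∃! a, a ∈ j₁ ⁻¹' T ∧ D₁.src a = x := by
  have key : ∀ a, D.src a = f₁ x → ∃ b, j₁ b = a ∧ D₁.src b = x := by
    intro a ha
    rcases h.cover a with ⟨b, rfl⟩ | ⟨b, rfl⟩
    · exact ⟨b, rfl, h.inj_f₁ ((h.src₁ b).symm.trans ha)⟩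
    · rw [h.src₂] at ha
      exact absurd (h.inj_f₁ ((h.eq_base _ _ ha.symm).trans h.f₁_base.symm)) hx
  constructor
  · rintro ⟨a, ⟨ha, hax⟩, huniq⟩
    obtain ⟨b, rfl, hb⟩ := key a hax
    exact ⟨b, ⟨ha, hb⟩, fun c hc => h.inj_j₁ (huniq _ ⟨hc.1, by rw [h.src₁, hc.2]⟩)⟩
  · rintro ⟨b, ⟨hb, hbx⟩, huniq⟩
    refine ⟨j₁ b, ⟨hb, by rw [h.src₁, hbx]⟩, ?_⟩
    rintro a ⟨ha, hax⟩
    obtain ⟨c, rfl, hc⟩ := key a hax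
    rw [huniq c ⟨ha, hc⟩]

theorem isArborescence_left (h : IsGluing D D₁ D₂ u v₁ v₂ f₁ f₂ j₁ j₂) {T : Set A}
    (hT : D.IsArborescence u T) : D₁.IsArborescence v₁ (j₁ ⁻¹' T) := by
  obtain ⟨h1, h2, h3⟩ := hT
  obtain ⟨π, hπ₁, hπ₂⟩ := h.exists_retraction
  refine ⟨fun a ha e => h1 _ ha ?_, fun x hx hxv => ?_, fun x hx => ?_⟩
  · rw [h.src₁, e, h.f₁_base]
  · exact (h.existsUnique_iff T hxv).1 (h2 _ (h.mem_verts hx)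
      fun e => hxv (h.inj_f₁ (e.trans h.f₁_base.symm)))
  · have hr := h3 _ (h.mem_verts hx)
    have : ∀ w w', D.Reach T w w' → D₁.Reach (j₁ ⁻¹' T) (π w) (π w') := by
      intro w w' hw
      induction hw with
      | refl => exact .refl
      | tail _ e ih =>
        obtain ⟨a, ha, rfl, rfl⟩ := e
        rcases h.cover a with ⟨b, rfl⟩ | ⟨b, rfl⟩
        · rw [h.src₁, hπ₁] at ih
          rw [h.tgt₁, hπ₁]
          exact ih.tail ⟨b, ha, rfl, rfl⟩
        · rw [h.src₂, hπ₂] at ih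
          rwa [h.tgt₂, hπ₂]
    have hr' := this _ _ hr
    rwa [hπ₁, ← h.f₁_base, hπ₁] at hr'

theorem reach_map (h : IsGluing D D₁ D₂ u v₁ v₂ f₁ f₂ j₁ j₂) {T : Set A} {x y : V₁}
    (hr : D₁.Reach (j₁ ⁻¹' T) x y) : D.Reach T (f₁ x) (f₁ y) :=
  Relation.ReflTransGen.lift f₁
    (fun _ _ ⟨a, ha, h1, h2⟩ => ⟨j₁ a, ha, by rw [h.src₁, h1], by rw [h.tgt₁, h2]⟩) _ _ hr

theorem isArborescence_iff (h : IsGluing D D₁ D₂ u v₁ v₂ f₁ f₂ j₁ j₂) {T : Set A} :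
    D.IsArborescence u T ↔
      D₁.IsArborescence v₁ (j₁ ⁻¹' T) ∧ D₂.IsArborescence v₂ (j₂ ⁻¹' T) := by
  refine ⟨fun hT => ⟨h.isArborescence_left hT, h.symm.isArborescence_left hT⟩, ?_⟩
  rintro ⟨⟨h1, h2, h3⟩, ⟨k1, k2, k3⟩⟩
  refine ⟨fun a ha e => ?_, fun w hw hwu => ?_, fun w hw => ?_⟩
  · rcases h.cover a with ⟨b, rfl⟩ | ⟨b, rfl⟩
    · exact h1 b ha (h.inj_f₁ (by rw [← h.src₁, e, h.f₁_base]))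
    · exact k1 b ha (h.inj_f₂ (by rw [← h.src₂, e, h.f₂_base]))
  · rcases h.exists_of_mem_verts hw with ⟨x, hx, rfl⟩ | ⟨x, hx, rfl⟩
    · have hxv : x ≠ v₁ := fun e => hwu (e ▸ h.f₁_base)
      exact (h.existsUnique_iff T hxv).2 (h2 x hx hxv)
    · have hxv : x ≠ v₂ := fun e => hwu (e ▸ h.f₂_base)
      exact (h.symm.existsUnique_iff T hxv).2 (k2 x hx hxv)
  · rcases h.exists_of_mem_verts hw with ⟨x, hx, rfl⟩ | ⟨x, hx, rfl⟩
    · exact h.f₁_base ▸ h.reach_map (h3 x hx)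
    · exact h.f₂_base ▸ h.symm.reach_map (k3 x hx)

theorem tauAt_eq (h : IsGluing D D₁ D₂ u v₁ v₂ f₁ f₂ j₁ j₂) :
    D.tauAt u = D₁.tauAt v₁ * D₂.tauAt v₂ := by
  rw [tauAt, tauAt, tauAt, ← Set.ncard_prod]
  refine Set.ncard_congr (fun T _ => (j₁ ⁻¹' T, j₂ ⁻¹' T)) ?_ ?_ ?_
  · exact fun T hT => h.isArborescence_iff.1 hT
  · intro S T _ _ e
    obtain ⟨e₁, e₂⟩ := Prod.mk.inj e
    ext a
    rcases h.cover a with ⟨b, rfl⟩ | ⟨b, rfl⟩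
    · exact Set.ext_iff.1 e₁ b
    · exact Set.ext_iff.1 e₂ b
  · rintro ⟨T₁, T₂⟩ ⟨hT₁ : D₁.IsArborescence v₁ T₁, hT₂ : D₂.IsArborescence v₂ T₂⟩
    have e₁ : j₁ ⁻¹' (j₁ '' T₁ ∪ j₂ '' T₂) = T₁ := by
      ext a
      simp only [Set.mem_preimage, Set.mem_union, h.inj_j₁.mem_set_image, or_iff_left_iff_imp]
      rintro ⟨b, -, hb⟩
      exact absurd hb.symm (h.disj a b)
    have e₂ : j₂ ⁻¹' (j₁ '' T₁ ∪ j₂ '' T₂) = T₂ := by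
      ext a
      simp only [Set.mem_preimage, Set.mem_union, h.inj_j₂.mem_set_image, or_iff_right_iff_imp]
      rintro ⟨b, -, hb⟩
      exact absurd hb (h.disj b a)
    exact ⟨j₁ '' T₁ ∪ j₂ '' T₂, h.isArborescence_iff.2 ⟨e₁.symm ▸ hT₁, e₂.symm ▸ hT₂⟩,
      Prod.ext e₁ e₂⟩

end IsGluing

/-! ### Relabelling the arcs -/

section Relabel

variable {V A B : Type*} {D : MultiDigraph V A} {D' : MultiDigraph V B} (e : B ≃ A)

/-- A digraph with its arcs relabelled is glued from the original digraph and a digraph without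
arcs. -/
theorem isGluing_of_equiv (hs : ∀ b, D'.src b = D.src (e b)) (ht : ∀ b, D'.tgt b = D.tgt (e b))
    (u : V) :
    IsGluing D D' (⟨Empty.elim, Empty.elim⟩ : MultiDigraph Unit Empty) u u () id
      (fun _ => u) e Empty.elim where
  inj_f₁ := Function.injective_id
  inj_f₂ := fun _ _ _ => rfl
  f₁_base := rfl
  f₂_base := rfl
  eq_base := fun _ _ h => h
  inj_j₁ := e.injective
  inj_j₂ := fun a => a.elim
  disj := fun _ b => b.elim
  cover := fun a => .inl ⟨e.symm a, e.apply_symm_apply a⟩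
  src₁ := fun b => (hs b).symm
  tgt₁ := fun b => (ht b).symm
  src₂ := fun a => a.elim
  tgt₂ := fun a => a.elim

end Relabel

theorem isTour_of_isEmpty {V A : Type*} [IsEmpty A] (D : MultiDigraph V A) (u : V) : D.IsTour u :=
  ⟨[], List.nodup_nil, fun a => isEmptyElim a, rfl⟩

/-- A digraph without arcs has one arborescence, the empty one: it has no vertices to be reached. -/
theorem tauAt_of_isEmpty {V A : Type*} [IsEmpty A] (D : MultiDigraph V A) (u : V) :
    D.tauAt u = 1 := by
  have hv : ∀ v, v ∉ D.verts := by
    rintro v (⟨a, -⟩ | ⟨a, -⟩) <;> exact isEmptyElim a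
  rw [tauAt, Set.ncard_eq_one]
  refine ⟨∅, Set.eq_singleton_iff_unique_mem.2 ⟨?_, fun T _ => Set.eq_empty_of_isEmpty T⟩⟩
  exact ⟨fun a => isEmptyElim a, fun v h => absurd h (hv v), fun v h => absurd h (hv v)⟩

end MultiDigraph

/-! ### Summation over tuples -/

section Tuples

open Finset

/-- The permutations that sort a tuple form a coset of its stabilizer. -/
theorem card_monotone_comp_perm {α : Type*} [LinearOrder α] {d : ℕ} (ρ : Fin d → α) :
    #{σ : Equiv.Perm (Fin d) | Monotone (ρ ∘ σ)} =
      ∏ v ∈ univ.image ρ, (Fintype.card {i // ρ i = v}).factorial := by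
  rw [← DomMulAct.stabilizer_card', ← Fintype.card_subtype]
  refine Fintype.card_congr ((Equiv.mulRight (Tuple.sort ρ)⁻¹).subtypeEquiv fun σ => ?_)
  rw [show Monotone (ρ ∘ σ) ↔ ρ ∘ σ = ρ ∘ Tuple.sort ρ from
    ⟨fun h => Tuple.unique_monotone h (Tuple.monotone_sort ρ), fun h => h ▸ Tuple.monotone_sort ρ⟩]
  simp only [Equiv.coe_mulRight, Equiv.Perm.coe_mul, funext_iff, Function.comp_apply]
  constructor
  · intro h i
    simpa using h ((Tuple.sort ρ)⁻¹ i)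
  · intro h i
    simpa using h (Tuple.sort ρ i)

/-- The sum of a symmetric function over the tuples with non-decreasing keys is a weighted sum over
all tuples. -/
theorem factorial_mul_sum_monotone {X α : Type*} [Fintype X] [LinearOrder α] (k : X → α) {d : ℕ}
    (φ : (Fin d → X) → ℚ) (hφ : ∀ (σ : Equiv.Perm (Fin d)) G, φ (G ∘ σ) = φ G) :
    (d.factorial : ℚ) * ∑ G : Fin d → X with Monotone (k ∘ G), φ G =
      ∑ G : Fin d → X, φ G *
        ∏ v ∈ univ.image (k ∘ G), ((Fintype.card {i // k (G i) = v}).factorial : ℚ) := by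
  have h1 : ∀ σ : Equiv.Perm (Fin d), ∑ G : Fin d → X with Monotone (k ∘ G), φ G =
      ∑ G : Fin d → X, if Monotone ((k ∘ G) ∘ σ) then φ G else 0 := by
    intro σ
    rw [sum_filter, ← (σ.symm.arrowCongr (Equiv.refl X)).sum_comp]
    refine sum_congr rfl fun G _ => ?_
    have : (σ.symm.arrowCongr (Equiv.refl X)) G = G ∘ σ := by ext; simp
    rw [this, hφ, Function.comp_assoc]
  calc (d.factorial : ℚ) * ∑ G : Fin d → X with Monotone (k ∘ G), φ G
      = ∑ σ : Equiv.Perm (Fin d), ∑ G : Fin d → X with Monotone (k ∘ G), φ G := by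
        rw [sum_const, card_univ, Fintype.card_perm, Fintype.card_fin, nsmul_eq_mul]
    _ = ∑ σ : Equiv.Perm (Fin d), ∑ G : Fin d → X,
          if Monotone ((k ∘ G) ∘ σ) then φ G else 0 := sum_congr rfl fun σ _ => h1 σ
    _ = _ := by
        rw [sum_comm]
        refine sum_congr rfl fun G _ => ?_
        rw [← sum_filter, sum_const, card_monotone_comp_perm, nsmul_eq_mul, mul_comm]
        push_cast
        rfl

/-- A sum over tuples in a disjoint union, split according to the positions of the entries from the
first part. -/
theorem sum_tuple_sum {X₁ X₂ : Type*} [Fintype X₁] [Fintype X₂] {d : ℕ}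
    (φ : (Fin d → X₁ ⊕ X₂) → ℚ) (ψ : ∀ d₁ d₂, (Fin d₁ → X₁) → (Fin d₂ → X₂) → ℚ)
    (h : ∀ d₁ d₂ (e : Fin d₁ ⊕ Fin d₂ ≃ Fin d) G₁ G₂,
      φ (Sum.map G₁ G₂ ∘ e.symm) = ψ d₁ d₂ G₁ G₂) :
    ∑ G, φ G = ∑ p ∈ antidiagonal d, (d.choose p.1 : ℚ) * ∑ G₁, ∑ G₂, ψ p.1 p.2 G₁ G₂ := by
  have key : ∀ S : Finset (Fin d),
      ∑ G : Fin d → X₁ ⊕ X₂ with ({i | (G i).isLeft} : Finset (Fin d)) = S, φ G =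
        ∑ G₁, ∑ G₂, ψ #S (d - #S) G₁ G₂ := by
    intro S
    have hS : #Sᶜ = d - #S := by rw [card_compl, Fintype.card_fin]
    set e := finSumEquivOfFinset (s := S) rfl hS with he
    have hl : ∀ i, e (Sum.inl i) ∈ S := fun i => by simp [he]
    have hr : ∀ i, e (Sum.inr i) ∉ S := fun i => by
      rw [← mem_compl, he, finSumEquivOfFinset_inr]; exact orderEmbOfFin_mem _ _ _
    rw [← Fintype.sum_prod_type']
    symm
    refine sum_bij (fun p _ => Sum.map p.1 p.2 ∘ e.symm) ?_ ?_ ?_ ?_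
    · rintro ⟨G₁, G₂⟩ -
      rw [mem_filter]
      refine ⟨mem_univ _, ?_⟩
      ext i
      obtain ⟨j, rfl⟩ := e.surjective i
      rcases j with j | j
      · simp [hl]
      · simp [hr]
    · rintro ⟨G₁, G₂⟩ - ⟨G₁', G₂'⟩ - heq
      refine Prod.ext (funext fun i => ?_) (funext fun i => ?_)
      · simpa using congrFun heq (e (Sum.inl i))
      · simpa using congrFun heq (e (Sum.inr i))
    · intro G hG
      rw [mem_filter] at hG
      have hG' : ∀ i, (G i).isLeft ↔ i ∈ S := fun i => by rw [← hG.2]; simp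
      have h1 : ∀ i, ∃ x, G (e (Sum.inl i)) = Sum.inl x := fun i =>
        Sum.isLeft_iff.1 ((hG' _).2 (hl i))
      have h2 : ∀ i, ∃ x, G (e (Sum.inr i)) = Sum.inr x := fun i =>
        Sum.isRight_iff.1 (by
          rw [← Sum.not_isLeft, hG']; exact hr i)
      choose G₁ hG₁ using h1
      choose G₂ hG₂ using h2
      refine ⟨(G₁, G₂), mem_univ _, funext fun i => ?_⟩
      obtain ⟨j, rfl⟩ := e.surjective i
      rcases j with j | j
      · simp [hG₁]
      · simp [hG₂]
    · rintro ⟨G₁, G₂⟩ -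
      exact (h _ _ e G₁ G₂).symm
  rw [← sum_fiberwise univ (fun G : Fin d → X₁ ⊕ X₂ => ({i | (G i).isLeft} : Finset (Fin d))),
    sum_congr rfl fun S _ => key S, ← powerset_univ,
    sum_powerset_apply_card (fun k => ∑ G₁, ∑ G₂, ψ k (d - k) G₁ G₂), card_univ, Fintype.card_fin,
    Nat.sum_antidiagonal_eq_sum_range_succ_mk]
  simp only [nsmul_eq_mul]

/-- A sum over the tuples with entries in a finite set `R`, as a sum over the tuples of elements of
the type `R`. -/
theorem finsum_mem_tuple {Y : Type*} {d : ℕ} (R : Set Y) [Fintype R] (P : (Fin d → Y) → Prop)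
    [DecidablePred P] (w : (Fin d → Y) → ℚ) :
    ∑ᶠ F ∈ {F : Fin d → Y | (∀ i, F i ∈ R) ∧ P F}, w F =
      ∑ G : Fin d → R with P (fun i => G i), w fun i => G i := by
  classical
  have hinj : Function.Injective fun (G : Fin d → R) i => (G i : Y) :=
    fun G G' h => funext fun i => Subtype.ext (congrFun h i)
  rw [← sum_image (s := univ.filter fun G : Fin d → R => P fun i => G i)
    (g := fun G i => (G i : Y)) hinj.injOn]
  rw [← finsum_mem_coe_finset]
  congr! 3 with F
  simp only [Set.mem_ofPred_eq, coe_image, coe_filter, mem_univ, true_and, Set.mem_image]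
  constructor
  · rintro ⟨h1, h2⟩
    exact ⟨fun i => ⟨F i, h1 i⟩, h2, rfl⟩
  · rintro ⟨G, h, rfl⟩
    exact ⟨fun i => (G i).2, h⟩

end Tuples

/-! ### Rooted sequences and their merging -/

/-- The image of a rooted edge under a map of vertices. -/
def RootedEdge.map {α β : Type*} (f : α → β) (x : RootedEdge α) : RootedEdge β :=
  ⟨f x.root, f '' x.edge⟩

/-- The rooted edges `e(v)` of `H`: `e` is an edge of `H` and `v ∈ e`. -/
def Hypergraph.rootedEdges {α : Type*} (H : Hypergraph α) : Set (RootedEdge α) :=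
  {x | x.edge ∈ H.edgeSet ∧ x.root ∈ x.edge}

theorem Hypergraph.finite_rootedEdges {α : Type*} {H : Hypergraph α} (h : H.vertexSet.Finite) :
    H.rootedEdges.Finite := by
  refine Set.Finite.of_finite_image (f := fun x => (x.root, x.edge))
    ((h.prod h.finite_subsets).subset ?_) ?_
  · rintro _ ⟨x, hx, rfl⟩
    have := Hypergraph.subset_vertexSet_of_mem_edgeSet hx.1
    exact ⟨this hx.2, this⟩
  · rintro ⟨a, b⟩ - ⟨c, d⟩ - h
    obtain ⟨rfl, rfl⟩ := Prod.mk.inj h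
    rfl

section RootCount

open Finset
open scoped Classical

variable {α : Type*} {d : ℕ}

theorem rootCount_eq_card (F : Fin d → RootedEdge α) (v : α) :
    rootCount F v = #{i | (F i).root = v} := by
  rw [rootCount, Set.ncard_eq_toFinset_card']
  congr 1
  ext; simp

theorem rootCount_eq_sum (F : Fin d → RootedEdge α) (v : α) :
    rootCount F v = ∑ i, if (F i).root = v then 1 else 0 := by
  rw [rootCount_eq_card, card_filter]

theorem rootCount_pos_iff {F : Fin d → RootedEdge α} {v : α} :
    0 < rootCount F v ↔ ∃ i, (F i).root = v := by
  rw [rootCount_eq_card, card_pos]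
  simp [Finset.Nonempty]

theorem rootCount_le (F : Fin d → RootedEdge α) (v : α) : rootCount F v ≤ d := by
  rw [rootCount_eq_card]
  exact (card_le_univ _).trans_eq (Fintype.card_fin d)

theorem rootCount_comp_perm (F : Fin d → RootedEdge α) (σ : Equiv.Perm (Fin d)) (v : α) :
    rootCount (F ∘ σ) v = rootCount F v := by
  rw [rootCount_eq_sum, rootCount_eq_sum]
  exact Equiv.sum_comp σ fun i => if (F i).root = v then 1 else 0

/-- The set of roots of `F`. -/
noncomputable def rootSet (F : Fin d → RootedEdge α) : Finset α :=
  univ.image fun i => (F i).root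

theorem mem_rootSet {F : Fin d → RootedEdge α} {v : α} : v ∈ rootSet F ↔ ∃ i, (F i).root = v := by
  simp [rootSet]

theorem rootSet_comp_perm (F : Fin d → RootedEdge α) (σ : Equiv.Perm (Fin d)) :
    rootSet (F ∘ σ) = rootSet F := by
  ext v
  rw [mem_rootSet, mem_rootSet]
  exact σ.exists_congr_left.trans (by simp)

/-- The product of `c (r_F(v))` over the roots `v ≠ u` of `F`. -/
noncomputable def rootProd (c : ℕ → ℚ) (u : α) (F : Fin d → RootedEdge α) : ℚ :=
  ∏ v ∈ (rootSet F).erase u, c (rootCount F v)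

theorem rootProd_comp_perm (c : ℕ → ℚ) (u : α) (F : Fin d → RootedEdge α)
    (σ : Equiv.Perm (Fin d)) : rootProd c u (F ∘ σ) = rootProd c u F := by
  simp only [rootProd, rootSet_comp_perm, rootCount_comp_perm]

end RootCount

/-- `F` is a shuffle, by `e`, of the images of the sequences `F₁` and `F₂` under injections `f₁`
and `f₂` of vertices whose images meet only in the vertex `u`. -/
structure IsMerge {V V₁ V₂ : Type*} {d d₁ d₂ : ℕ} (F : Fin d → RootedEdge V)
    (F₁ : Fin d₁ → RootedEdge V₁) (F₂ : Fin d₂ → RootedEdge V₂) (u : V) (v₁ : V₁) (v₂ : V₂)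
    (f₁ : V₁ → V) (f₂ : V₂ → V) (e : Fin d₁ ⊕ Fin d₂ ≃ Fin d) : Prop where
  inj_f₁ : f₁.Injective
  inj_f₂ : f₂.Injective
  f₁_base : f₁ v₁ = u
  f₂_base : f₂ v₂ = u
  eq_base : ∀ x y, f₁ x = f₂ y → f₁ x = u
  left : ∀ i, F (e (.inl i)) = (F₁ i).map f₁
  right : ∀ i, F (e (.inr i)) = (F₂ i).map f₂

namespace IsMerge

variable {V V₁ V₂ : Type*} {d d₁ d₂ : ℕ} {F : Fin d → RootedEdge V}
  {F₁ : Fin d₁ → RootedEdge V₁} {F₂ : Fin d₂ → RootedEdge V₂} {u : V} {v₁ : V₁} {v₂ : V₂}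
  {f₁ : V₁ → V} {f₂ : V₂ → V} {e : Fin d₁ ⊕ Fin d₂ ≃ Fin d}

theorem symm (h : IsMerge F F₁ F₂ u v₁ v₂ f₁ f₂ e) :
    IsMerge F F₂ F₁ u v₂ v₁ f₂ f₁ ((Equiv.sumComm _ _).trans e) where
  inj_f₁ := h.inj_f₂
  inj_f₂ := h.inj_f₁
  f₁_base := h.f₂_base
  f₂_base := h.f₁_base
  eq_base := fun x y e => e.trans (h.eq_base y x e.symm)
  left := h.right
  right := h.left

theorem root_left (h : IsMerge F F₁ F₂ u v₁ v₂ f₁ f₂ e) (i : Fin d₁) :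
    (F (e (.inl i))).root = f₁ (F₁ i).root := by rw [h.left]; rfl

theorem root_right (h : IsMerge F F₁ F₂ u v₁ v₂ f₁ f₂ e) (i : Fin d₂) :
    (F (e (.inr i))).root = f₂ (F₂ i).root := by rw [h.right]; rfl

open Classical in
theorem rootCount_base (h : IsMerge F F₁ F₂ u v₁ v₂ f₁ f₂ e) :
    rootCount F u = rootCount F₁ v₁ + rootCount F₂ v₂ := by
  rw [rootCount_eq_sum, rootCount_eq_sum, rootCount_eq_sum, ← e.sum_comp, Fintype.sum_sum_type]
  simp only [h.root_left, h.root_right]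
  congr 1
  · simp only [← h.f₁_base, h.inj_f₁.eq_iff]
  · simp only [← h.f₂_base, h.inj_f₂.eq_iff]

open Classical in
theorem rootCount_left (h : IsMerge F F₁ F₂ u v₁ v₂ f₁ f₂ e) {x : V₁} (hx : x ≠ v₁) :
    rootCount F (f₁ x) = rootCount F₁ x := by
  have hne : ∀ y, f₂ y ≠ f₁ x := fun y hy =>
    hx (h.inj_f₁ ((h.eq_base x y hy.symm).trans h.f₁_base.symm))
  rw [rootCount_eq_sum, rootCount_eq_sum, ← e.sum_comp, Fintype.sum_sum_type]
  simp only [h.root_left, h.root_right, h.inj_f₁.eq_iff, hne, if_false, Finset.sum_const_zero,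
    add_zero]

open Classical in
theorem rootSet_erase (h : IsMerge F F₁ F₂ u v₁ v₂ f₁ f₂ e) :
    (rootSet F).erase u =
      ((rootSet F₁).erase v₁).image f₁ ∪ ((rootSet F₂).erase v₂).image f₂ := by
  ext w
  simp only [Finset.mem_erase, Finset.mem_union, Finset.mem_image, mem_rootSet]
  constructor
  · rintro ⟨hw, i, rfl⟩
    obtain ⟨j, rfl⟩ := e.surjective i
    rcases j with j | j
    · refine .inl ⟨_, ⟨fun hj => hw ?_, j, rfl⟩, (h.root_left j).symm⟩
      rw [h.root_left, hj, h.f₁_base]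
    · refine .inr ⟨_, ⟨fun hj => hw ?_, j, rfl⟩, (h.root_right j).symm⟩
      rw [h.root_right, hj, h.f₂_base]
  · rintro (⟨x, ⟨hx, i, rfl⟩, rfl⟩ | ⟨x, ⟨hx, i, rfl⟩, rfl⟩)
    · exact ⟨fun hw => hx (h.inj_f₁ (hw.trans h.f₁_base.symm)), _, h.root_left i⟩
    · exact ⟨fun hw => hx (h.inj_f₂ (hw.trans h.f₂_base.symm)), _, h.root_right i⟩

open Classical in
theorem rootProd_eq (h : IsMerge F F₁ F₂ u v₁ v₂ f₁ f₂ e) (c : ℕ → ℚ) :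
    rootProd c u F = rootProd c v₁ F₁ * rootProd c v₂ F₂ := by
  rw [rootProd, h.rootSet_erase, Finset.prod_union, Finset.prod_image h.inj_f₁.injOn,
    Finset.prod_image h.inj_f₂.injOn]
  · congr 1
    · exact Finset.prod_congr rfl fun x hx => by rw [h.rootCount_left (Finset.ne_of_mem_erase hx)]
    · exact Finset.prod_congr rfl fun x hx => by
        rw [h.symm.rootCount_left (Finset.ne_of_mem_erase hx)]
  · rw [Finset.disjoint_left]
    intro w hw hw'
    obtain ⟨x, hx, rfl⟩ := Finset.mem_image.1 hw
    obtain ⟨y, -, hy⟩ := Finset.mem_image.1 hw'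
    exact Finset.ne_of_mem_erase hx
      (h.inj_f₁ ((h.eq_base x y hy.symm).trans h.f₁_base.symm))

theorem mem_left (h : IsMerge F F₁ F₂ u v₁ v₂ f₁ f₂ e) (i : Fin d₁) (x : V₁) :
    (f₁ x ∈ (F (e (.inl i))).edge ∧ f₁ x ≠ (F (e (.inl i))).root) ↔
      x ∈ (F₁ i).edge ∧ x ≠ (F₁ i).root := by
  rw [h.left]
  exact and_congr h.inj_f₁.mem_set_image h.inj_f₁.ne_iff

/-- `R(F)` is glued from `R(F₁)` and `R(F₂)`. -/
theorem isGluing (h : IsMerge F F₁ F₂ u v₁ v₂ f₁ f₂ e) :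
    (starUnion F).IsGluing (starUnion F₁) (starUnion F₂) u v₁ v₂ f₁ f₂
      (fun a => ⟨(e (.inl a.1.1), f₁ a.1.2), (h.mem_left _ _).2 a.2⟩)
      (fun a => ⟨(e (.inr a.1.1), f₂ a.1.2), (h.symm.mem_left _ _).2 a.2⟩) where
  inj_f₁ := h.inj_f₁
  inj_f₂ := h.inj_f₂
  f₁_base := h.f₁_base
  f₂_base := h.f₂_base
  eq_base := h.eq_base
  inj_j₁ := by
    rintro ⟨⟨i, x⟩, hx⟩ ⟨⟨j, y⟩, hy⟩ heq
    have h1 := congrArg (fun a => a.1.1) heq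
    have h2 := congrArg (fun a => a.1.2) heq
    simp only [e.injective.eq_iff, Sum.inl.injEq] at h1
    exact Subtype.ext (Prod.ext h1 (h.inj_f₁ h2))
  inj_j₂ := by
    rintro ⟨⟨i, x⟩, hx⟩ ⟨⟨j, y⟩, hy⟩ heq
    have h1 := congrArg (fun a => a.1.1) heq
    have h2 := congrArg (fun a => a.1.2) heq
    simp only [e.injective.eq_iff, Sum.inr.injEq] at h1
    exact Subtype.ext (Prod.ext h1 (h.inj_f₂ h2))
  disj := by
    rintro a b heq
    have h1 := congrArg (fun a => a.1.1) heq
    simp at h1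
  cover := by
    rintro ⟨⟨i, w⟩, hw, hw'⟩
    obtain ⟨j, rfl⟩ := e.surjective i
    rcases j with j | j
    · left
      have hw2 := hw
      simp only [h.left] at hw2
      obtain ⟨x, hx, rfl⟩ := hw2
      exact ⟨⟨(j, x), (h.mem_left _ _).1 ⟨hw, hw'⟩⟩, rfl⟩
    · right
      have hw2 := hw
      simp only [h.right] at hw2
      obtain ⟨x, hx, rfl⟩ := hw2
      exact ⟨⟨(j, x), (h.symm.mem_left _ _).1 ⟨hw, hw'⟩⟩, rfl⟩
  src₁ := fun a => h.root_left a.1.1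
  tgt₁ := fun _ => rfl
  src₂ := fun a => h.root_right a.1.1
  tgt₂ := fun _ => rfl

end IsMerge

/-- Permuting a sequence only relabels the arcs of its digraph. -/
def starArcPermEquiv {α : Type*} {d : ℕ} (F : Fin d → RootedEdge α) (σ : Equiv.Perm (Fin d)) :
    StarArc (F ∘ σ) ≃ StarArc F :=
  (σ.prodCongr (Equiv.refl α)).subtypeEquiv fun _ => Iff.rfl

section Perm

variable {α : Type*} {d : ℕ} (F : Fin d → RootedEdge α) (σ : Equiv.Perm (Fin d)) (u : α)

theorem isTour_comp_perm : (starUnion (F ∘ σ)).IsTour u ↔ (starUnion F).IsTour u := by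
  rw [(MultiDigraph.isGluing_of_equiv (D' := starUnion (F ∘ σ)) (starArcPermEquiv F σ)
    (fun _ => rfl) (fun _ => rfl) u).isTour_iff, and_iff_left (MultiDigraph.isTour_of_isEmpty _ _)]

theorem tauAt_comp_perm : (starUnion (F ∘ σ)).tauAt u = (starUnion F).tauAt u := by
  rw [(MultiDigraph.isGluing_of_equiv (D' := starUnion (F ∘ σ)) (starArcPermEquiv F σ)
    (fun _ => rfl) (fun _ => rfl) u).tauAt_eq,
    MultiDigraph.tauAt_of_isEmpty ⟨Empty.elim, Empty.elim⟩ (), mul_one]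

end Perm

/-! ### The weight of a rooted sequence -/

section Weight

open Finset
open scoped Classical

variable {α : Type*} {H : Hypergraph α} {m d : ℕ} {F : Fin d → RootedEdge α} {u : α}

theorem exists_starArc (hm : H.IsUniform m) (hF : ∀ i, F i ∈ H.rootedEdges) (i : Fin d) :
    ∃ a : StarArc F, a.1.1 = i := by
  have h1 : 1 < (F i).edge.ncard := by rw [hm.2 _ (hF i).1]; exact hm.1
  obtain ⟨x, hx, hx'⟩ := Set.exists_ne_of_one_lt_ncard h1 (F i).root
  exact ⟨⟨(i, x), hx, hx'⟩, rfl⟩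

theorem finite_edge (hm : H.IsUniform m) (hF : ∀ i, F i ∈ H.rootedEdges) (i : Fin d) :
    (F i).edge.Finite :=
  Set.finite_of_ncard_pos (by rw [hm.2 _ (hF i).1]; have := hm.1; omega)

theorem finite_starArc (hm : H.IsUniform m) (hF : ∀ i, F i ∈ H.rootedEdges) :
    Finite (StarArc F) := by
  have := fun i => (finite_edge hm hF i).to_subtype
  refine Finite.of_injective
    (fun p : StarArc F => (⟨p.1.1, ⟨p.1.2, p.2.1⟩⟩ : Σ i, (F i).edge)) ?_
  rintro ⟨⟨i, x⟩, hx⟩ ⟨⟨j, y⟩, hy⟩ h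
  simp only [Sigma.mk.injEq] at h
  obtain ⟨rfl, h⟩ := h
  simp only [heq_eq_eq, Subtype.mk.injEq] at h
  subst h
  rfl

theorem outDegree_starUnion (hm : H.IsUniform m) (hF : ∀ i, F i ∈ H.rootedEdges) (v : α) :
    (starUnion F).outDegree v = (m - 1) * rootCount F v := by
  have := fun i => (finite_edge hm hF i).to_subtype
  let E : {a : StarArc F // (starUnion F).src a = v} ≃
      Σ i : {i // (F i).root = v}, ((F i).edge \ {(F i).root} : Set α) :=
    { toFun := fun a => ⟨⟨a.1.1.1, a.2⟩, ⟨a.1.1.2, a.1.2⟩⟩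
      invFun := fun b => ⟨⟨(b.1.1, b.2.1), b.2.2⟩, b.1.2⟩
      left_inv := fun _ => rfl
      right_inv := fun _ => rfl }
  have := fun i => ((finite_edge hm hF i).sdiff (t := {(F i).root})).to_subtype
  rw [MultiDigraph.outDegree, ← Nat.card_coe_set_eq]
  refine (Nat.card_congr E).trans ?_
  rw [Nat.card_sigma, sum_congr rfl (g := fun _ => m - 1), sum_const, card_univ,
    Fintype.card_subtype, ← rootCount_eq_card, smul_eq_mul, mul_comm]
  intro i _
  rw [Nat.card_coe_set_eq, Set.ncard_sdiff_singleton_of_mem (hF i).2, hm.2 _ (hF i).1]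

/-- For a nonempty sequence, an Euler tour based at `u` is an Euler circuit through `u`. -/
theorem isEulerian_and_rootCount_pos_iff (hm : H.IsUniform m) (hF : ∀ i, F i ∈ H.rootedEdges) :
    (starUnion F).IsEulerian ∧ 0 < rootCount F u ↔ (starUnion F).IsTour u ∧ d ≠ 0 := by
  constructor
  · rintro ⟨h, hu⟩
    obtain ⟨i, rfl⟩ := rootCount_pos_iff.1 hu
    obtain ⟨a, rfl⟩ := exists_starArc hm hF i
    exact ⟨h.isTour a, fun h0 => by subst h0; exact a.1.1.elim0⟩
  · rintro ⟨h, hd⟩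
    obtain ⟨a, -⟩ := exists_starArc hm hF ⟨0, Nat.pos_of_ne_zero hd⟩
    have : Nonempty (StarArc F) := ⟨a⟩
    obtain ⟨b, hb⟩ := h.exists_src_eq
    exact ⟨h.isEulerian, rootCount_pos_iff.2 ⟨b.1.1, hb⟩⟩

/-- In an Eulerian `R(F)` every vertex is a root, because it has an arc out of it. -/
theorem verts_starUnion (hm : H.IsUniform m) (hF : ∀ i, F i ∈ H.rootedEdges)
    (h : (starUnion F).IsEulerian) : (starUnion F).verts = rootSet F := by
  have := finite_starArc hm hF
  have := Fintype.ofFinite (StarArc F)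
  ext v
  rw [mem_coe, mem_rootSet]
  constructor
  · intro hv
    obtain ⟨a, ha⟩ : ∃ a, (starUnion F).src a = v := by
      rcases hv with hv | ⟨a, rfl⟩
      · exact hv
      · have hpos : 0 < #{b | (starUnion F).tgt b = (starUnion F).tgt a} :=
          card_pos.2 ⟨a, by simp⟩
        rw [← h.balanced] at hpos
        obtain ⟨b, hb⟩ := card_pos.1 hpos
        exact ⟨b, (mem_filter.1 hb).2⟩
    exact ⟨a.1.1, ha⟩
  · rintro ⟨i, rfl⟩
    obtain ⟨a, rfl⟩ := exists_starArc hm hF i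
    exact (starUnion F).src_mem_verts a

/-- The part `(m - 1)ⁿ⁻¹ τ_u(F) / ∏_{v ≠ u} d⁺_F(v)` of the weight `ω(F)` that is multiplicative under
gluing at `u`; it is `0` unless `R(F)` has an Euler tour based at `u`. The product is written over
the roots of `F`, which are then the vertices of `R(F)`, and with `d⁺_F(v) = (m - 1) r_F(v)`. -/
noncomputable def baseWeight (H : Hypergraph α) (m : ℕ) (u : α) (F : Fin d → RootedEdge α) : ℚ :=
  if (starUnion F).IsTour u then
    ((m : ℚ) - 1) ^ (H.vertexSet.ncard - 1) * ((starUnion F).tauAt u : ℚ) /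
      rootProd (fun r => ((m : ℚ) - 1) * r) u F
  else 0

theorem baseWeight_comp_perm (H : Hypergraph α) (m : ℕ) (u : α) (F : Fin d → RootedEdge α)
    (σ : Equiv.Perm (Fin d)) : baseWeight H m u (F ∘ σ) = baseWeight H m u F := by
  simp only [baseWeight, isTour_comp_perm, tauAt_comp_perm, rootProd_comp_perm]

theorem weight_eq (hfin : H.vertexSet.Finite) (hne : H.vertexSet.Nonempty) (hm : H.IsUniform m)
    (hF : ∀ i, F i ∈ H.rootedEdges) (h : (starUnion F).IsTour u) (hd : d ≠ 0) :
    H.weight m F = (d : ℚ) / (rootCount F u : ℚ) * baseWeight H m u F := by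
  obtain ⟨hE, hu⟩ := (isEulerian_and_rootCount_pos_iff hm hF).2 ⟨h, hd⟩
  have := finite_starArc hm hF
  have hu' : u ∈ rootSet F := mem_rootSet.2 (rootCount_pos_iff.1 hu)
  have hverts := verts_starUnion hm hF hE
  have hm1 : ((m : ℚ) - 1) ≠ 0 := by
    have : (2 : ℚ) ≤ m := by exact_mod_cast hm.1
    intro h0
    linarith
  have hdeg : ∀ v, ((starUnion F).outDegree v : ℚ) = ((m : ℚ) - 1) * rootCount F v := by
    intro v
    rw [outDegree_starUnion hm hF, Nat.cast_mul, Nat.cast_sub (by have := hm.1; omega),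
      Nat.cast_one]
  have hn : H.vertexSet.ncard = H.vertexSet.ncard - 1 + 1 :=
    (Nat.sub_add_cancel ((Set.ncard_pos hfin).2 hne)).symm
  rw [Hypergraph.weight, hE.tau_eq (u := u) (by rw [hverts]; exact hu'), hverts,
    finprod_mem_coe_finset, prod_congr rfl fun v _ => hdeg v, ← mul_prod_erase _ _ hu',
    baseWeight, if_pos h, rootProd, hn, pow_succ, Nat.add_sub_cancel, div_mul_div_comm]
  refine Eq.trans ?_ (mul_div_mul_left _ _ hm1)
  congr 1 <;> ring

/-- The number of permutations that fix the sequence of roots, with the factor of the vertex `u`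
kept apart. -/
noncomputable def symmetryFactor (u : α) (F : Fin d → RootedEdge α) : ℚ :=
  ((rootCount F u).factorial : ℚ) * rootProd (fun r => (r.factorial : ℚ)) u F

theorem prod_factorial_eq (u : α) (F : Fin d → RootedEdge α) :
    ∏ v ∈ rootSet F, ((rootCount F v).factorial : ℚ) = symmetryFactor u F := by
  rw [symmetryFactor, rootProd]
  by_cases hu : u ∈ rootSet F
  · rw [mul_prod_erase (rootSet F) (fun v => ((rootCount F v).factorial : ℚ)) hu]
  · have h0 : rootCount F u = 0 := by
      by_contra h0
      exact hu (mem_rootSet.2 (rootCount_pos_iff.1 (Nat.pos_of_ne_zero h0)))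
    rw [erase_eq_of_notMem hu, h0, Nat.factorial_zero, Nat.cast_one, one_mul]

end Weight

namespace IsMerge

variable {V V₁ V₂ : Type*} {d d₁ d₂ : ℕ} {F : Fin d → RootedEdge V}
  {F₁ : Fin d₁ → RootedEdge V₁} {F₂ : Fin d₂ → RootedEdge V₂} {u : V} {v₁ : V₁} {v₂ : V₂}
  {f₁ : V₁ → V} {f₂ : V₂ → V} {e : Fin d₁ ⊕ Fin d₂ ≃ Fin d}

theorem baseWeight_eq (h : IsMerge F F₁ F₂ u v₁ v₂ f₁ f₂ e) {H : Hypergraph V}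
    {H₁ : Hypergraph V₁} {H₂ : Hypergraph V₂} (m : ℕ)
    (hn : H.vertexSet.ncard - 1 = (H₁.vertexSet.ncard - 1) + (H₂.vertexSet.ncard - 1)) :
    baseWeight H m u F = baseWeight H₁ m v₁ F₁ * baseWeight H₂ m v₂ F₂ := by
  by_cases h₁ : (starUnion F₁).IsTour v₁
  · by_cases h₂ : (starUnion F₂).IsTour v₂
    · rw [baseWeight, baseWeight, baseWeight, if_pos h₁, if_pos h₂,
        if_pos (h.isGluing.isTour_iff.2 ⟨h₁, h₂⟩), h.isGluing.tauAt_eq, h.rootProd_eq, hn, pow_add,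
        div_mul_div_comm, Nat.cast_mul]
      congr 1
      ring
    · rw [baseWeight, if_neg (fun ht => h₂ (h.isGluing.isTour_iff.1 ht).2), baseWeight, baseWeight,
        if_neg h₂, mul_zero]
  · rw [baseWeight, if_neg (fun ht => h₁ (h.isGluing.isTour_iff.1 ht).1), baseWeight,
      if_neg h₁, zero_mul]

/-- Symmetry factors multiply under merging, up to the number of ways to shuffle the entries with
root `u`. -/
theorem symmetryFactor_eq (h : IsMerge F F₁ F₂ u v₁ v₂ f₁ f₂ e) :
    symmetryFactor u F = ((rootCount F₁ v₁ + rootCount F₂ v₂).choose (rootCount F₁ v₁) : ℚ) *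
      (symmetryFactor v₁ F₁ * symmetryFactor v₂ F₂) := by
  rw [symmetryFactor, symmetryFactor, symmetryFactor, h.rootCount_base, h.rootProd_eq,
    Nat.choose_symm_add, ← Nat.add_choose_mul_factorial_mul_factorial]
  push_cast
  ring

end IsMerge

/-! ### Traces as sums over tuples of rooted edges -/

section Trace

open Finset

variable {α : Type*} [LinearOrder α] {H : Hypergraph α} {m d : ℕ} {u : α}
  [Fintype H.rootedEdges]

/-- The sequence of roots of a tuple of rooted edges. -/
abbrev rootsOf (G : Fin d → H.rootedEdges) : Fin d → α := fun i => (G i).1.root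

/-- The summand for `r_F(u) = 0` is `0`, since then the quotient `d / 0` is `0`. -/
theorem trAt_eq_sum (hfin : H.vertexSet.Finite) (hne : H.vertexSet.Nonempty)
    (hm : H.IsUniform m) :
    H.trAt m d u = ∑ G : Fin d → H.rootedEdges with Monotone (rootsOf G),
      (d : ℚ) / (rootCount (fun i => (G i).1) u : ℚ) * baseWeight H m u fun i => (G i).1 := by
  classical
  have hset : {F | F ∈ H.eulerSeqs d ∧ 0 < rootCount F u} =
      {F : Fin d → RootedEdge α | (∀ i, F i ∈ H.rootedEdges) ∧
        (Monotone (fun i => (F i).root) ∧ (starUnion F).IsEulerian ∧ 0 < rootCount F u)} := by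
    ext F
    simp only [Hypergraph.eulerSeqs, Hypergraph.rootedSeqs, Hypergraph.rootedEdges, Monotone,
      Set.mem_ofPred_eq, and_assoc]
  rw [Hypergraph.trAt, hset, finsum_mem_tuple, sum_filter, sum_filter]
  refine sum_congr rfl fun G _ => ?_
  have hG : ∀ i, (G i).1 ∈ H.rootedEdges := fun i => (G i).2
  by_cases hs : Monotone (rootsOf G)
  · rw [if_pos hs]
    by_cases ht : (starUnion fun i => (G i).1).IsEulerian ∧ 0 < rootCount (fun i => (G i).1) u
    · obtain ⟨ht', hd⟩ := (isEulerian_and_rootCount_pos_iff hm hG).1 ht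
      rw [if_pos ⟨hs, ht⟩, weight_eq hfin hne hm hG ht' hd]
    · rw [if_neg fun h => ht h.2]
      rw [isEulerian_and_rootCount_pos_iff hm hG, not_and_or, not_not] at ht
      rcases ht with ht | rfl
      · rw [baseWeight, if_neg ht, mul_zero]
      · simp
  · rw [if_neg hs, if_neg fun h => hs h.1]

/-- The conventions for `Tr_{0;0}`, `Tr_{d;0}` and `0 / 0` say that the formula also holds when
`t = 0`. -/
theorem ratioOne_mul_trAtCount (hfin : H.vertexSet.Finite) (hne : H.vertexSet.Nonempty)
    (hm : H.IsUniform m) (t : ℕ) :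
    ratioOne t d * H.trAtCount m d t u =
      ∑ G : Fin d → H.rootedEdges with Monotone (rootsOf G),
        if rootCount (fun i => (G i).1) u = t then baseWeight H m u (fun i => (G i).1) else 0 := by
  classical
  rcases Nat.eq_zero_or_pos d with rfl | hd
  · have hr : ∀ F : Fin 0 → RootedEdge α, rootCount F u = 0 := fun F =>
      Nat.le_zero.1 (rootCount_le F u)
    rcases Nat.eq_zero_or_pos t with rfl | ht
    · have : ∀ F : Fin 0 → RootedEdge α, IsEmpty (StarArc F) := fun F => ⟨fun a => a.1.1.elim0⟩
      have hmono : Monotone (rootsOf (default : Fin 0 → H.rootedEdges)) := fun i => i.elim0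
      rw [sum_filter, Fintype.sum_unique, if_pos hmono, if_pos (hr _), baseWeight,
        if_pos (MultiDigraph.isTour_of_isEmpty _ _), MultiDigraph.tauAt_of_isEmpty, rootProd,
        ratioOne, if_pos ⟨rfl, rfl⟩, Hypergraph.trAtCount, if_pos ⟨rfl, rfl⟩]
      simp [rootSet]
    · rw [ratioOne, if_neg (by omega), Nat.cast_zero, div_zero, zero_mul]
      refine (sum_eq_zero fun G _ => ?_).symm
      rw [if_neg (by rw [hr]; omega)]
  · have hset : {F | F ∈ H.eulerSeqs d ∧ 0 < rootCount F u ∧ rootCount F u = t} =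
        {F : Fin d → RootedEdge α | (∀ i, F i ∈ H.rootedEdges) ∧
          (Monotone (fun i => (F i).root) ∧ ((starUnion F).IsEulerian ∧ 0 < rootCount F u) ∧
            rootCount F u = t)} := by
      ext F
      simp only [Hypergraph.eulerSeqs, Hypergraph.rootedSeqs, Hypergraph.rootedEdges, Monotone,
        Set.mem_ofPred_eq, and_assoc]
    rw [ratioOne, if_neg (by omega), Hypergraph.trAtCount, if_neg (by omega), hset,
      finsum_mem_tuple, mul_sum, sum_filter, sum_filter]
    refine sum_congr rfl fun G _ => ?_
    have hG : ∀ i, (G i).1 ∈ H.rootedEdges := fun i => (G i).2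
    by_cases hs : Monotone (rootsOf G)
    · rw [if_pos hs]
      by_cases hrt : rootCount (fun i => (G i).1) u = t
      · rw [if_pos hrt]
        by_cases ht : (starUnion fun i => (G i).1).IsEulerian ∧
            0 < rootCount (fun i => (G i).1) u
        · obtain ⟨ht', hd'⟩ := (isEulerian_and_rootCount_pos_iff hm hG).1 ht
          have hd0 : (d : ℚ) ≠ 0 := by exact_mod_cast hd'
          have ht0 : (t : ℚ) ≠ 0 := by rw [← hrt]; exact_mod_cast ht.2.ne'
          rw [if_pos ⟨hs, ht, hrt⟩, weight_eq hfin hne hm hG ht' hd', hrt]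
          field_simp
        · rw [if_neg fun h => ht h.2.1]
          rw [isEulerian_and_rootCount_pos_iff hm hG, not_and_or, not_not] at ht
          rw [baseWeight, if_neg (ht.resolve_right hd.ne')]
      · rw [if_neg hrt, if_neg fun h => hrt h.2.2]
    · rw [if_neg hs, if_neg fun h => hs h.1]

/-- `factorial_mul_sum_monotone` for rooted sequences: the weighted sum on the right no longer
involves the order of the vertices. -/
theorem factorial_mul_sum_sorted (u : α) (φ : (Fin d → RootedEdge α) → ℚ)
    (hφ : ∀ (σ : Equiv.Perm (Fin d)) F, φ (F ∘ σ) = φ F) :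
    (d.factorial : ℚ) * ∑ G : Fin d → H.rootedEdges with Monotone (rootsOf G),
        φ (fun i => (G i).1) =
      ∑ G : Fin d → H.rootedEdges, φ (fun i => (G i).1) * symmetryFactor u fun i => (G i).1 := by
  classical
  refine (factorial_mul_sum_monotone (fun x : H.rootedEdges => x.1.root)
    (fun G => φ fun i => (G i).1) fun σ G => hφ σ fun i => (G i).1).trans ?_
  refine sum_congr rfl fun G _ => ?_
  rw [← prod_factorial_eq, rootSet]
  congr 1
  refine prod_congr (by congr!) fun v _ => ?_
  rw [rootCount_eq_card, Fintype.card_subtype]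
  congr!

end Trace

/-! ### Rooted sequences of a coalescence -/

namespace CoalVertex

variable {α β : Type*}

theorem ofLeft_injective (β : Type*) (v₁ : α) : (ofLeft β v₁).Injective := by
  intro x y h
  unfold ofLeft at h
  split_ifs at h with hx hy hy
  · rw [hx, hy]
  · exact left.inj h

theorem ofRight_injective (α : Type*) (v₂ : β) : (ofRight α v₂).Injective := by
  intro x y h
  unfold ofRight at h
  split_ifs at h with hx hy hy
  · rw [hx, hy]
  · exact right.inj h

theorem ofLeft_base (β : Type*) (v₁ : α) : ofLeft β v₁ v₁ = glued := if_pos rfl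

theorem ofRight_base (α : Type*) (v₂ : β) : ofRight α v₂ v₂ = glued := if_pos rfl

theorem ofLeft_eq_base {v₁ : α} {v₂ : β} (x : α) (y : β) (h : ofLeft β v₁ x = ofRight α v₂ y) :
    ofLeft β v₁ x = glued := by
  unfold ofLeft ofRight at *
  split_ifs at h ⊢
  rfl

end CoalVertex

theorem RootedEdge.map_injective {α β : Type*} {f : α → β} (hf : f.Injective) :
    (RootedEdge.map f).Injective := by
  rintro ⟨x, e⟩ ⟨y, e'⟩ h
  simp only [RootedEdge.map, RootedEdge.mk.injEq] at h
  rw [hf h.1, hf.image_injective h.2]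

section Coalescence

open CoalVertex Finset

variable {α β : Type*} {H₁ : Hypergraph α} {H₂ : Hypergraph β} {v₁ : α} {v₂ : β}

theorem ncard_vertexSet_coalescence (hfin₁ : H₁.vertexSet.Finite) (hfin₂ : H₂.vertexSet.Finite)
    (hv₁ : v₁ ∈ H₁.vertexSet) (hv₂ : v₂ ∈ H₂.vertexSet) :
    (H₁.coalescence v₁ H₂ v₂).vertexSet.ncard - 1 =
      (H₁.vertexSet.ncard - 1) + (H₂.vertexSet.ncard - 1) := by
  have h := Set.ncard_union_add_ncard_inter (ofLeft β v₁ '' H₁.vertexSet)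
    (ofRight α v₂ '' H₂.vertexSet) (hfin₁.image _) (hfin₂.image _)
  have hinter : ofLeft β v₁ '' H₁.vertexSet ∩ ofRight α v₂ '' H₂.vertexSet = {glued} := by
    refine Set.eq_singleton_iff_unique_mem.2
      ⟨⟨⟨v₁, hv₁, ofLeft_base β v₁⟩, ⟨v₂, hv₂, ofRight_base α v₂⟩⟩, ?_⟩
    rintro w ⟨⟨x, -, rfl⟩, ⟨y, -, hy⟩⟩
    exact ofLeft_eq_base x y hy.symm
  rw [hinter, Set.ncard_singleton, Set.ncard_image_of_injective _ (ofLeft_injective β v₁),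
    Set.ncard_image_of_injective _ (ofRight_injective α v₂)] at h
  have h₁ := (Set.ncard_pos hfin₁).2 ⟨v₁, hv₁⟩
  have h₂ := (Set.ncard_pos hfin₂).2 ⟨v₂, hv₂⟩
  change (ofLeft β v₁ '' H₁.vertexSet ∪ ofRight α v₂ '' H₂.vertexSet).ncard - 1 = _
  omega

theorem isUniform_coalescence {m : ℕ} (h₁ : H₁.IsUniform m) (h₂ : H₂.IsUniform m) :
    (H₁.coalescence v₁ H₂ v₂).IsUniform m := by
  refine ⟨h₁.1, ?_⟩
  rintro _ (⟨e, he, rfl⟩ | ⟨e, he, rfl⟩)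
  · rw [Set.ncard_image_of_injective _ (ofLeft_injective β v₁), h₁.2 e he]
  · rw [Set.ncard_image_of_injective _ (ofRight_injective α v₂), h₂.2 e he]

/-- The rooted edges of the coalescence are those of the two hypergraphs. No edge comes from both,
because an edge has two vertices and the two vertex sets share only one. -/
theorem exists_rootedEdges_equiv {m : ℕ} (hm : H₁.IsUniform m) :
    ∃ E : H₁.rootedEdges ⊕ H₂.rootedEdges ≃ (H₁.coalescence v₁ H₂ v₂).rootedEdges,
      (∀ x, (E (.inl x)).1 = x.1.map (ofLeft β v₁)) ∧
        ∀ y, (E (.inr y)).1 = y.1.map (ofRight α v₂) := by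
  let g : H₁.rootedEdges ⊕ H₂.rootedEdges → (H₁.coalescence v₁ H₂ v₂).rootedEdges :=
    Sum.elim
      (fun x => ⟨x.1.map (ofLeft β v₁), .inl ⟨_, x.2.1, rfl⟩, Set.mem_image_of_mem _ x.2.2⟩)
      (fun y => ⟨y.1.map (ofRight α v₂), .inr ⟨_, y.2.1, rfl⟩, Set.mem_image_of_mem _ y.2.2⟩)
  have hdisj : ∀ (x : H₁.rootedEdges) (y : H₂.rootedEdges),
      x.1.map (ofLeft β v₁) ≠ y.1.map (ofRight α v₂) := by
    intro x y h
    have hedge : ofLeft β v₁ '' x.1.edge = ofRight α v₂ '' y.1.edge :=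
      congrArg RootedEdge.edge h
    have h1 : 1 < x.1.edge.ncard := by rw [hm.2 _ x.2.1]; exact hm.1
    obtain ⟨a, ha, hav⟩ := Set.exists_ne_of_one_lt_ncard h1 v₁
    obtain ⟨b, -, hb⟩ := hedge ▸ Set.mem_image_of_mem (ofLeft β v₁) ha
    exact hav (ofLeft_injective β v₁
      ((ofLeft_eq_base a b hb.symm).trans (ofLeft_base β v₁).symm))
  have hg : g.Bijective := by
    constructor
    · rintro (x | x) (y | y) h
      · exact congrArg Sum.inl (Subtype.ext
          (RootedEdge.map_injective (ofLeft_injective β v₁) (congrArg Subtype.val h)))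
      · exact absurd (congrArg Subtype.val h) (hdisj x y)
      · exact absurd (congrArg Subtype.val h).symm (hdisj y x)
      · exact congrArg Sum.inr (Subtype.ext
          (RootedEdge.map_injective (ofRight_injective α v₂) (congrArg Subtype.val h)))
    · rintro ⟨⟨r, e⟩, he : e ∈ (H₁.coalescence v₁ H₂ v₂).edgeSet, hr : r ∈ e⟩
      rcases he with ⟨e', he', rfl⟩ | ⟨e', he', rfl⟩ <;> obtain ⟨x, hx, rfl⟩ := hr
      · exact ⟨.inl ⟨⟨x, e'⟩, he', hx⟩, rfl⟩
      · exact ⟨.inr ⟨⟨x, e'⟩, he', hx⟩, rfl⟩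
  exact ⟨Equiv.ofBijective g hg, fun _ => rfl, fun _ => rfl⟩

end Coalescence

/-! ### The trace of a coalescence -/

section Sums

open Finset

/-- Summation of `K (a i) (b j) x_i y_j` by the values of `a` and `b`. -/
theorem sum_range_product_ite {ι κ : Type*} (s : Finset ι) (t : Finset κ) (a : ι → ℕ) (b : κ → ℕ)
    (x : ι → ℚ) (y : κ → ℚ) (K : ℕ → ℕ → ℚ) {n k : ℕ} (ha : ∀ i ∈ s, a i < n)
    (hb : ∀ j ∈ t, b j < k) :
    ∑ q ∈ range n ×ˢ range k, K q.1 q.2 * (∑ i ∈ s, if a i = q.1 then x i else 0) *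
        (∑ j ∈ t, if b j = q.2 then y j else 0) =
      ∑ i ∈ s, ∑ j ∈ t, K (a i) (b j) * x i * y j := by
  have h : ∀ q : ℕ × ℕ, K q.1 q.2 * (∑ i ∈ s, if a i = q.1 then x i else 0) *
      (∑ j ∈ t, if b j = q.2 then y j else 0) =
      ∑ i ∈ s, ∑ j ∈ t, if q = (a i, b j) then K (a i) (b j) * x i * y j else 0 := by
    intro q
    rw [mul_assoc, sum_mul_sum, mul_sum]
    refine sum_congr rfl fun i _ => ?_
    rw [mul_sum]
    refine sum_congr rfl fun j _ => ?_
    obtain ⟨q₁, q₂⟩ := q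
    simp only [Prod.mk.injEq]
    by_cases h1 : a i = q₁ <;> by_cases h2 : b j = q₂ <;>
      simp [h1, h2, mul_assoc, eq_comm (a := q₁), eq_comm (a := q₂)]
  rw [sum_congr rfl fun q _ => h q, sum_comm]
  refine sum_congr rfl fun i hi => ?_
  rw [sum_comm]
  refine sum_congr rfl fun j hj => ?_
  rw [sum_ite_eq', if_pos (by simp [ha i hi, hb j hj])]

end Sums

theorem lemma3p1 {α β : Type*} [LinearOrder α] [LinearOrder β] [LinearOrder (CoalVertex α β)]
    (m : ℕ) (H₁ : Hypergraph α) (H₂ : Hypergraph β) (v₁ : α) (v₂ : β)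
    (hfin₁ : H₁.vertexSet.Finite) (hfin₂ : H₂.vertexSet.Finite)
    (hnt₁ : H₁.vertexSet.Nontrivial) (hnt₂ : H₂.vertexSet.Nontrivial)
    (hconn₁ : H₁.IsConnected) (hconn₂ : H₂.IsConnected)
    (hunif₁ : H₁.IsUniform m) (hunif₂ : H₂.IsUniform m)
    (hv₁ : v₁ ∈ H₁.vertexSet) (hv₂ : v₂ ∈ H₂.vertexSet) (d : ℕ) :
    (H₁.coalescence v₁ H₂ v₂).trAt m d CoalVertex.glued =
      ∑ p ∈ Finset.HasAntidiagonal.antidiagonal d,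
        ∑ q ∈ (Finset.range (p.1 + 1) ×ˢ Finset.range (p.2 + 1)).filter (fun q => 0 < q.1 + q.2),
          (d : ℚ) / ((q.1 + q.2 : ℕ) : ℚ) * ((q.1 + q.2).choose q.1 : ℚ) *
            (ratioOne q.1 p.1 * H₁.trAtCount m p.1 q.1 v₁) *
            (ratioOne q.2 p.2 * H₂.trAtCount m p.2 q.2 v₂) := by
  set H := H₁.coalescence v₁ H₂ v₂ with hH
  have hfin : H.vertexSet.Finite := (hfin₁.image _).union (hfin₂.image _)
  have hne : H.vertexSet.Nonempty := ⟨_, .inl ⟨v₁, hv₁, rfl⟩⟩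
  have hunif : H.IsUniform m := isUniform_coalescence hunif₁ hunif₂
  let := (Hypergraph.finite_rootedEdges hfin).fintype
  let := (Hypergraph.finite_rootedEdges hfin₁).fintype
  let := (Hypergraph.finite_rootedEdges hfin₂).fintype
  obtain ⟨E, hE₁, hE₂⟩ := exists_rootedEdges_equiv (H₂ := H₂) (v₁ := v₁) (v₂ := v₂) hunif₁
  let K : ℕ → ℕ → ℚ := fun s t => (d : ℚ) / ((s + t : ℕ) : ℚ) * ((s + t).choose s : ℚ)
  let w₁ : ∀ {k}, (Fin k → RootedEdge α) → ℚ := fun F => baseWeight H₁ m v₁ F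
  let w₂ : ∀ {k}, (Fin k → RootedEdge β) → ℚ := fun F => baseWeight H₂ m v₂ F
  let r₁ : ∀ {k}, (Fin k → RootedEdge α) → ℕ := fun F => rootCount F v₁
  let r₂ : ∀ {k}, (Fin k → RootedEdge β) → ℕ := fun F => rootCount F v₂
  -- For each pair of lengths, the sum over both sorted sequences, made a sum over all sequences.
  have hsorted : ∀ d₁ d₂ : ℕ, (d₁.factorial : ℚ) * (d₂.factorial : ℚ) *
      (∑ G₁ : Fin d₁ → H₁.rootedEdges with Monotone (rootsOf G₁),
        ∑ G₂ : Fin d₂ → H₂.rootedEdges with Monotone (rootsOf G₂),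
          K (r₁ fun i => (G₁ i).1) (r₂ fun i => (G₂ i).1) * w₁ (fun i => (G₁ i).1) *
            w₂ (fun i => (G₂ i).1)) =
      ∑ G₁ : Fin d₁ → H₁.rootedEdges, ∑ G₂ : Fin d₂ → H₂.rootedEdges,
        K (r₁ fun i => (G₁ i).1) (r₂ fun i => (G₂ i).1) * w₁ (fun i => (G₁ i).1) *
          w₂ (fun i => (G₂ i).1) * symmetryFactor v₂ (fun i => (G₂ i).1) *
            symmetryFactor v₁ (fun i => (G₁ i).1) := by
    intro d₁ d₂
    have h₂ : ∀ F₁ : Fin d₁ → RootedEdge α, (d₂.factorial : ℚ) *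
        ∑ G₂ : Fin d₂ → H₂.rootedEdges with Monotone (rootsOf G₂),
          K (r₁ F₁) (r₂ fun i => (G₂ i).1) * w₁ F₁ * w₂ (fun i => (G₂ i).1) =
        ∑ G₂ : Fin d₂ → H₂.rootedEdges, K (r₁ F₁) (r₂ fun i => (G₂ i).1) * w₁ F₁ *
          w₂ (fun i => (G₂ i).1) * symmetryFactor v₂ (fun i => (G₂ i).1) := fun F₁ =>
      factorial_mul_sum_sorted v₂ (fun F₂ => K (r₁ F₁) (r₂ F₂) * w₁ F₁ * w₂ F₂)
        fun σ F₂ => by simp only [r₂, w₂, rootCount_comp_perm, baseWeight_comp_perm]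
    have h₁ := factorial_mul_sum_sorted (H := H₁) (d := d₁) v₁
      (fun F₁ => ∑ G₂ : Fin d₂ → H₂.rootedEdges, K (r₁ F₁) (r₂ fun i => (G₂ i).1) * w₁ F₁ *
          w₂ (fun i => (G₂ i).1) * symmetryFactor v₂ (fun i => (G₂ i).1))
        fun σ F₁ => by simp only [r₁, w₁, rootCount_comp_perm, baseWeight_comp_perm]
    rw [mul_assoc, Finset.mul_sum, Finset.sum_congr rfl fun G₁ _ => h₂ _, h₁]
    exact Finset.sum_congr rfl fun G₁ _ => Finset.sum_mul _ _ _
  -- The right-hand side. The terms excluded by the filter vanish, since `d / 0 = 0`.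
  have hrhs : ∀ p : ℕ × ℕ,
      ∑ q ∈ (Finset.range (p.1 + 1) ×ˢ Finset.range (p.2 + 1)).filter (fun q => 0 < q.1 + q.2),
          (d : ℚ) / ((q.1 + q.2 : ℕ) : ℚ) * ((q.1 + q.2).choose q.1 : ℚ) *
            (ratioOne q.1 p.1 * H₁.trAtCount m p.1 q.1 v₁) *
            (ratioOne q.2 p.2 * H₂.trAtCount m p.2 q.2 v₂) =
      ∑ G₁ : Fin p.1 → H₁.rootedEdges with Monotone (rootsOf G₁),
        ∑ G₂ : Fin p.2 → H₂.rootedEdges with Monotone (rootsOf G₂),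
          K (r₁ fun i => (G₁ i).1) (r₂ fun i => (G₂ i).1) * w₁ (fun i => (G₁ i).1) *
            w₂ (fun i => (G₂ i).1) := by
    intro p
    rw [Finset.sum_filter_of_ne fun q _ hq => Nat.pos_of_ne_zero fun h0 => hq (by simp [h0]),
      ← sum_range_product_ite _ _ (fun G₁ : Fin p.1 → H₁.rootedEdges => r₁ fun i => (G₁ i).1)
        (fun G₂ : Fin p.2 → H₂.rootedEdges => r₂ fun i => (G₂ i).1) _ _ K
        (fun _ _ => Nat.lt_succ_of_le (rootCount_le _ _))
        (fun _ _ => Nat.lt_succ_of_le (rootCount_le _ _))]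
    refine Finset.sum_congr rfl fun q _ => ?_
    rw [ratioOne_mul_trAtCount hfin₁ ⟨v₁, hv₁⟩ hunif₁, ratioOne_mul_trAtCount hfin₂ ⟨v₂, hv₂⟩ hunif₂]
  rw [Finset.sum_congr rfl fun p _ => hrhs p, trAt_eq_sum hfin hne hunif]
  have hd : (d.factorial : ℚ) ≠ 0 := by exact_mod_cast d.factorial_ne_zero
  refine mul_left_cancel₀ hd ?_
  rw [factorial_mul_sum_sorted CoalVertex.glued
    (fun F => (d : ℚ) / (rootCount F CoalVertex.glued : ℚ) * baseWeight H m CoalVertex.glued F)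
    fun σ F => by simp only [rootCount_comp_perm, baseWeight_comp_perm],
    ← ((Equiv.refl (Fin d)).arrowCongr E).sum_comp,
    sum_tuple_sum _ fun d₁ d₂ G₁ G₂ =>
      K (r₁ fun i => (G₁ i).1) (r₂ fun i => (G₂ i).1) * w₁ (fun i => (G₁ i).1) *
        w₂ (fun i => (G₂ i).1) * symmetryFactor v₂ (fun i => (G₂ i).1) *
          symmetryFactor v₁ (fun i => (G₁ i).1), Finset.mul_sum]
  · refine Finset.sum_congr rfl fun p hp => ?_
    obtain rfl := Finset.HasAntidiagonal.mem_antidiagonal.1 hp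
    rw [← hsorted, ← mul_assoc, Nat.choose_symm_add,
      ← Nat.add_choose_mul_factorial_mul_factorial]
    push_cast
    ring
  · intro d₁ d₂ e G₁ G₂
    have hmerge : IsMerge
        (fun i => ((((Equiv.refl (Fin d)).arrowCongr E) (Sum.map G₁ G₂ ∘ e.symm)) i).1)
        (fun i => (G₁ i).1) (fun i => (G₂ i).1) CoalVertex.glued v₁ v₂
        (CoalVertex.ofLeft β v₁) (CoalVertex.ofRight α v₂) e :=
      { inj_f₁ := CoalVertex.ofLeft_injective β v₁
        inj_f₂ := CoalVertex.ofRight_injective α v₂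
        f₁_base := CoalVertex.ofLeft_base β v₁
        f₂_base := CoalVertex.ofRight_base α v₂
        eq_base := CoalVertex.ofLeft_eq_base
        left := fun i => by simp [hE₁]
        right := fun i => by simp [hE₂] }
    rw [hmerge.baseWeight_eq m (ncard_vertexSet_coalescence hfin₁ hfin₂ hv₁ hv₂),
      hmerge.symmetryFactor_eq, hmerge.rootCount_base]
    simp only [K, w₁, w₂, r₁, r₂]
    ring
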